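/- Let $F$ be a non-archimedean local field of characteristic $0$ with a fixed algebraic closure $\overline F$, absolute Galois group $\Gamma_F$, inertia group $I_F$ and Weil group $W_F\subset\Gamma_F$. Let $n\ge 1$ and let $\omega$ be an unramified character of $F^\times$ of order $n$, regarded as the character $\omega\circ\det$ of $H(F)$, where $H=GL(n)$. Let $E/F$ be an unramified extension of degree $m\geq 1$ in $\overline F$, $\theta$ a generator of $\mathrm{Gal}(E/F)$, $G=\mathrm{Res}_{E/F}(H_E)$, $\tilde G=G\theta$, and let $\omega_E$ be the unramified character of $G(F)=GL(n,E)$ extending $\omega$. Fix a Frobenius element $\phi\in W_F$ and integers $e,a,b$ with $\phi^e|_E=\theta$ and $bm-ae=1$. *Dual side.* Put $\hat H=GL(n,\mathbb C)$, with trivial action of $W_F$ and $\hat\theta_H=1$, and $\hat G=\hat H^{m}$ with $\hat\theta(x_1,\dots,x_m)=(x_2,\dots,x_m,x_1)$; the group $W_F$ acts on $\hat G$ through $\mathrm{Gal}(E/F)$, with $\theta$ acting as $\hat\theta$, so that $\phi$ acts as $\hat\theta^{-a}$. Let $\hat T_H$ be the diagonal torus of $\hat H$ and $\hat T=\hat T_H^{m}$.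 Put ${}^LH=\hat H\rtimes W_F$ and ${}^LG=\hat G\rtimes W_F$. To $\omega$ is attached the class of the unramified cocycle $W_F\to Z(\hat H)=\mathbb C^\times$ with value $a(\phi)=\omega(\varpi)$ at Frobenius ($\varpi$ a uniformizer), and to $\omega_E$ the class of the unramified cocycle $W_F\to Z(\hat G)$ with value $(1,\dots,1,a(\phi))$ at Frobenius. *Data.* An elliptic unramified endoscopic datum for $(\tilde G,\omega_E)$ with a torus as underlying group is a triple $(T',\mathcal T',\tilde s)$ consisting of an $F$-torus $T'$, a closed subgroup $\mathcal T'\subset{}^LG$ and an element $\tilde s=s\hat\theta$ of $\hat G\hat\theta$ such that: $\tilde s$ is semisimple (conjugate under $\hat G$ to an element of $\hat T\hat\theta$); $\mathcal T'$ is a split extension of $W_F$ by the neutral component $\hat G_{\tilde s}$ of the centralizer of $\tilde s$ in $\hat G$; $\hat G_{\tilde s}$, with the action of $W_F$ given by conjugation in $\mathcal T'$, is the dual torus $\hat T'$ of $T'$; there is a cocycle $c$ in the class attached to $\omega_E$ with $\mathrm{Int}_{\tilde s}(x,w)=(x\,c(w),w)$ for all $(x,w)\in\mathcal T'$; $I_F\subset\mathcal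 T'$; and $(\hat T'^{\,\Gamma_F})^\circ=(Z(\hat G)^{\Gamma_F,\hat\theta})^\circ$. Two data are isomorphic if there is $x\in\hat G$ with $x\mathcal T'_1x^{-1}=\mathcal T'_2$ and $x\tilde s_1x^{-1}\in Z(\hat G)\tilde s_2$. Let $\mathfrak E_{\rm t\text{-}nr}(\tilde G,\omega_E)$ be the set of isomorphism classes, and define $\mathfrak E_{\rm t\text{-}nr}(H,\omega)$ in the same way from $\hat H$, with $\hat\theta_H=1$ in place of $\hat\theta$. *Construction.* Let $\mathbf T'_H=(T'_H,\mathcal T'_H,s_H)$ be such a datum for $(H,\omega)$ with $s_H\in\hat T_H$ (every isomorphism class contains one), and choose $(h_H,\phi)\in\mathcal T'_H$. Put $T'=T'_H$, $\tilde s=(1,\dots,1,s_H)\hat\theta$ and $$h=(\underbrace{h_H,\dots,h_H}_{a\bmod m},h_Hs_H,\dots,h_Hs_H)\in\hat G$$ (with $a \bmod m\in\{0,\dots,m-1\}$), let $\mathcal T'$ be the subgroup of ${}^LG$ generated by $\hat G_{\tilde s}$, $I_F$ and $(h,\phi)$, and put $\mathbf T'=(T',\mathcal T',\tilde s)$. **Lemma.**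 $\mathbf T'$ is an elliptic unramified endoscopic datum for $(\tilde G,\omega_E)$ with a torus as underlying group. Its isomorphism class depends only on the isomorphism class of $\mathbf T'_H$ (and not on the choice of $(h_H,\phi)\in\mathcal T'_H$, nor on the Frobenius element $\phi$ used in it), and the resulting map $$\mathfrak E_{\rm t\text{-}nr}(H,\omega)\longrightarrow\mathfrak E_{\rm t\text{-}nr}(\tilde G,\omega_E)$$ is bijective. -/

import Mathlib

open ValuativeRel

set_option linter.unusedSectionVars false

noncomputable section

namespace Endoscopy

/-! ### Inertia, Frobenius elements and the Weil group of a local field -/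

section Galois

variable (F : Type*) [Field F] [ValuativeRel F] [TopologicalSpace F]
  [IsNonarchimedeanLocalField F]

/-- The absolute Galois group `Γ_F`, for the algebraic closure `AlgebraicClosure F` of `F`. -/
abbrev GaloisGroup : Type _ := AlgebraicClosure F ≃ₐ[F] AlgebraicClosure F

/-- The ring of integers of the algebraic closure. -/
abbrev IntegersBar : Type _ := integralClosure 𝒪[F] (AlgebraicClosure F)

/-- The maximal ideal of the ring of integers of the algebraic closure: the radical of the
ideal generated by the maximal ideal of `𝒪[F]`. -/
def maxIdealBar : Ideal (IntegersBar F) :=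
  (Ideal.map (algebraMap 𝒪[F] (IntegersBar F)) 𝓂[F]).radical

/-- The inertia group `I_F ⊆ Γ_F`. -/
def inertiaGroup : Subgroup (GaloisGroup F) :=
  Ideal.inertia (GaloisGroup F) (maxIdealBar F)

/-- `σ` acts on the residue field of the algebraic closure by `x ↦ x ^ q`, where `q` is the
cardinality of the residue field of `F`. -/
def IsFrobeniusElt (σ : GaloisGroup F) : Prop :=
  ∀ x : IntegersBar F, σ • x - x ^ Nat.card 𝓀[F] ∈ maxIdealBar F

/-- The Weil group `W_F ⊆ Γ_F`, generated by the inertia group and the Frobenius elements. -/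
def weilGroup : Subgroup (GaloisGroup F) :=
  inertiaGroup F ⊔ Subgroup.closure {σ | IsFrobeniusElt F σ}

/-- The maximal unramified extension of `F` in the algebraic closure. -/
def maxUnramified : IntermediateField F (AlgebraicClosure F) :=
  IntermediateField.fixedField (inertiaGroup F)

/-- A torus `T'` over `F`, given by its character module: `X^*(T') = ℤ ^ rank` with the
continuous action `act` of `Γ_F`. -/
structure FTorus where
  rank : ℕ
  act : GaloisGroup F →* GL (Fin rank) ℤ
  isOpen_ker : IsOpen (act.ker : Set (GaloisGroup F))

variable {F}

/-- The action of `σ ∈ Γ_F` on the complex dual torus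
`T̂' = X^*(T') ⊗ ℂˣ = (ℂˣ) ^ rank` of `T'`. -/
def FTorus.dualAct (T : FTorus F) (σ : GaloisGroup F) (t : Fin T.rank → ℂˣ) : Fin T.rank → ℂˣ :=
  fun i => ∏ j, t j ^ ((T.act σ : Matrix (Fin T.rank) (Fin T.rank) ℤ) i j)

end Galois

/-- The algebra `ℂ[t_1^{±1}, …, t_r^{±1}]` of regular functions on the complex torus `(ℂˣ) ^ r`. -/
def laurent (r : ℕ) : Subalgebra ℂ ((Fin r → ℂˣ) → ℂ) :=
  Algebra.adjoin ℂ
    (Set.range (fun (j : Fin r) (t : Fin r → ℂˣ) => ((t j : ℂˣ) : ℂ)) ∪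
      Set.range (fun (j : Fin r) (t : Fin r → ℂˣ) => (((t j)⁻¹ : ℂˣ) : ℂ)))

/-- The neutral component of a subgroup `S` of a topological group, as a subgroup of the whole
group. For an algebraic subgroup of a complex algebraic group (with its complex topology) it
is the neutral component in the sense of algebraic groups. -/
def neutral {X : Type*} [Group X] [TopologicalSpace X] [IsTopologicalGroup X]
    (S : Subgroup X) : Subgroup X :=
  (Subgroup.connectedComponentOfOne S).map S.subtype

/-! ### Endoscopic data whose underlying group is a torus -/

section Data

variable (F : Type*) [Field F] [ValuativeRel F] [TopologicalSpace F]
  [IsNonarchimedeanLocalField F]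
variable (X : Type) [Group X] [TopologicalSpace X] [IsTopologicalGroup X]

/-- The dual side of an unramified pair `(G̃, ω)`, for a dual group `X = Ĝ`:
* a maximal torus `T̂`, part of a Borel pair of `Ĝ` stable under `θ̂` and the Galois action;
* functions on `Ĝ` which are the matrix coefficients of a closed embedding of `Ĝ` in a
  general linear group;
* the action of `W_F` on `Ĝ`, with `ᴸG = Ĝ ⋊ W_F`;
* the automorphism `θ̂`;
* the value at Frobenius of an unramified cocycle `W_F → Z(Ĝ)` whose class `𝐚` corresponds
  to `ω`. -/
structure DualSide where
  torus : Subgroup X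
  coeffs : Set (X → ℂ)
  galAct : weilGroup F →* MulAut X
  theta : MulAut X
  aFrob : X

variable {F X}

namespace DualSide

variable (D : DualSide F X)

/-- The `L`-group `ᴸG = Ĝ ⋊ W_F`. -/
abbrev LGroup : Type _ := X ⋊[D.galAct] (weilGroup F)

/-- `Ĝ_s̃` for `s̃ = s θ̂`: the neutral component of the centralizer
`{x | s θ̂(x) s⁻¹ = x}` of `s̃` in `Ĝ`. -/
def connCentralizer (s : X) : Subgroup X :=
  neutral (MonoidHom.eqLocus (MulAut.conj s * D.theta).toMonoidHom (MonoidHom.id X))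

/-- `Z(Ĝ)^{Γ_F, θ̂}`. -/
def centerInvariants : Subgroup X :=
  Subgroup.center X ⊓ MonoidHom.eqLocus D.theta.toMonoidHom (MonoidHom.id X) ⊓
    ⨅ w : weilGroup F, MonoidHom.eqLocus (D.galAct w).toMonoidHom (MonoidHom.id X)

/-- The map `a : W_F → Z(Ĝ)` is a cocycle in the class `𝐚`: up to a coboundary, it is trivial
on inertia with value `aFrob` at the Frobenius elements. -/
def IsCocycleInClass (a : weilGroup F → X) : Prop :=
  (∀ w, a w ∈ Subgroup.center X) ∧
  (∀ w w', a (w * w') = a w * D.galAct w (a w')) ∧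
  ∃ z ∈ Subgroup.center X, ∀ w : weilGroup F,
    ((w : GaloisGroup F) ∈ inertiaGroup F → z * a w * (D.galAct w z)⁻¹ = 1) ∧
    (IsFrobeniusElt F (w : GaloisGroup F) → z * a w * (D.galAct w z)⁻¹ = D.aFrob)

/-- A triple `(T', 𝒯', s̃)` with `T'` a torus over `F`, `𝒯'` a subgroup of `ᴸG` and
`s̃ = s θ̂ ∈ Ĝ θ̂`. -/
structure Triple where
  torus : FTorus F
  group : Subgroup D.LGroup
  s : X

variable {D}

/-- `(T', 𝒯', s̃)` is an elliptic unramified endoscopic datum for `(G̃, ω)`. That `𝒯'` is closed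
and that the extension is split need not be required: since `𝒯'` contains `I_F`, it is the
semidirect product of `Ĝ_s̃ × I_F` by the group generated by any `(h, φ) ∈ 𝒯'` with `φ` a
Frobenius element. -/
structure Triple.IsDatum (T : D.Triple) : Prop where
  /-- `s̃` is semisimple, i.e. `Int(s̃)` stabilizes a Borel pair of `Ĝ`: some conjugate of `s̃`
  lies in `T̂ θ̂`. -/
  semisimple : ∃ x : X, x * T.s * (D.theta x)⁻¹ ∈ D.torus
  /-- `1 → Ĝ_s̃ → 𝒯' → W_F → 1` is exact. -/
  inter : T.group.comap SemidirectProduct.inl = D.connCentralizer T.s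
  surj : ∀ w : weilGroup F, ∃ x : X, (⟨x, w⟩ : D.LGroup) ∈ T.group
  /-- `Ĝ_s̃`, with the action of `W_F` defined by conjugation in `𝒯'`, is the dual torus
  of `T'`. -/
  dual : ∃ ι : (Fin T.torus.rank → ℂˣ) →* X,
    Function.Injective ι ∧ ι.range = D.connCentralizer T.s ∧
    (∀ u ∈ D.coeffs, (fun t => u (ι t)) ∈ laurent T.torus.rank) ∧
    ∀ (x : X) (w : weilGroup F), (⟨x, w⟩ : D.LGroup) ∈ T.group →
      ∀ t, x * D.galAct w (ι t) * x⁻¹ = ι (T.torus.dualAct (w : GaloisGroup F) t)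
  /-- `Int(s̃)(x, w) = (x a(w), w)` on `𝒯'`, for some cocycle `a` in the class `𝐚`. -/
  cocycle : ∃ a : weilGroup F → X, D.IsCocycleInClass a ∧
    ∀ (x : X) (w : weilGroup F), (⟨x, w⟩ : D.LGroup) ∈ T.group →
      T.s * D.theta x * (D.galAct w T.s)⁻¹ = x * a w
  /-- The datum is unramified: `I_F ⊆ 𝒯'`. -/
  unramified : ∀ w : weilGroup F, (w : GaloisGroup F) ∈ inertiaGroup F →
    (⟨1, w⟩ : D.LGroup) ∈ T.group
  /-- The datum is elliptic: `(T̂'^{Γ_F})° = (Z(Ĝ)^{Γ_F, θ̂})°`. -/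
  elliptic :
    neutral (D.connCentralizer T.s ⊓
      (Subgroup.centralizer (T.group : Set D.LGroup)).comap SemidirectProduct.inl) =
    neutral D.centerInvariants

/-- Isomorphism of data: `x 𝒯'₁ x⁻¹ = 𝒯'₂` and `x s̃₁ x⁻¹ ∈ Z(Ĝ) s̃₂` for some `x ∈ Ĝ`. -/
def Triple.Iso (T₁ T₂ : D.Triple) : Prop :=
  ∃ x : X,
    T₁.group.map (MulAut.conj (SemidirectProduct.inl x : D.LGroup)).toMonoidHom = T₂.group ∧
    ∃ z ∈ Subgroup.center X, x * T₁.s * (D.theta x)⁻¹ = z * T₂.s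

theorem Triple.Iso.refl (T : D.Triple) : T.Iso T := by
  refine ⟨1, ?_, 1, Subgroup.one_mem _, by simp⟩
  ext y
  simp

theorem Triple.Iso.symm {T₁ T₂ : D.Triple} (h : T₁.Iso T₂) : T₂.Iso T₁ := by
  obtain ⟨x, hx, z, hz, hs⟩ := h
  refine ⟨x⁻¹, ?_, z⁻¹, Subgroup.inv_mem _ hz, ?_⟩
  · rw [← hx, Subgroup.map_map]
    ext y
    simp [Subgroup.mem_map, mul_assoc]
  · have h1 : T₂.s = z⁻¹ * (x * T₁.s * (D.theta x)⁻¹) := by rw [hs]; group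
    have h2 : x⁻¹ * z⁻¹ = z⁻¹ * x⁻¹ := Subgroup.mem_center_iff.mp (Subgroup.inv_mem _ hz) x⁻¹
    rw [h1, ← mul_assoc, h2, map_inv]
    group

theorem Triple.Iso.trans {T₁ T₂ T₃ : D.Triple} (h : T₁.Iso T₂) (h' : T₂.Iso T₃) :
    T₁.Iso T₃ := by
  obtain ⟨x, hx, z, hz, hs⟩ := h
  obtain ⟨y, hy, z', hz', hs'⟩ := h'
  refine ⟨y * x, ?_, z * z', Subgroup.mul_mem _ hz hz', ?_⟩
  · rw [← hy, ← hx, Subgroup.map_map]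
    congr 1
    ext u <;> simp [mul_assoc]
  · have h2 : y * z = z * y := Subgroup.mem_center_iff.mp hz y
    calc y * x * T₁.s * (D.theta (y * x))⁻¹
        = y * (x * T₁.s * (D.theta x)⁻¹) * (D.theta y)⁻¹ := by rw [map_mul]; group
      _ = y * z * T₂.s * (D.theta y)⁻¹ := by rw [hs]; group
      _ = z * (y * T₂.s * (D.theta y)⁻¹) := by rw [h2]; group
      _ = z * z' * T₃.s := by rw [hs']; group

variable (D)

/-- Elliptic unramified endoscopic data for `(G̃, ω)` whose underlying group is a torus. -/
def Datum : Type _ := {T : D.Triple // T.IsDatum}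

instance datumSetoid : Setoid D.Datum where
  r T₁ T₂ := T₁.1.Iso T₂.1
  iseqv := ⟨fun T => Triple.Iso.refl T.1, Triple.Iso.symm, Triple.Iso.trans⟩

/-- `𝔈_{t-nr}(G̃, ω)`: isomorphism classes of elliptic unramified endoscopic data whose
underlying group is a torus. -/
def Classes : Type _ := Quotient D.datumSetoid

variable {D}

/-- The isomorphism class of a datum. -/
def Datum.cls (T : D.Datum) : D.Classes := Quotient.mk D.datumSetoid T

end DualSide

end Data

/-! ### The groups `H = GL(n)` and `G = Res_{E/F} GL(n)` -/

/-- The diagonal torus of `GL(n, ℂ)`. -/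
def diagTorus (n : ℕ) : Subgroup (GL (Fin n) ℂ) :=
  (Units.map (Matrix.diagonalRingHom (Fin n) ℂ).toMonoidHom).range

section GLn

variable (F : Type*) [Field F] [ValuativeRel F] [TopologicalSpace F]
  [IsNonarchimedeanLocalField F]

/-- The dual side of `(H, ω)` for `H = GL(n)` split over `F`: `Ĥ = GL(n, ℂ)`, with trivial
action of `W_F` and `θ̂ = 1`; `a` is the value at Frobenius of the unramified character
`W_F → ℂˣ = Z(Ĥ)` corresponding to `ω`. -/
def dualH (n : ℕ) (a : ℂˣ) : DualSide F (GL (Fin n) ℂ) where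
  torus := diagTorus n
  coeffs := Set.range fun (p : Fin n × Fin n) (x : GL (Fin n) ℂ) =>
    (x : Matrix (Fin n) (Fin n) ℂ) p.1 p.2
  galAct := 1
  theta := 1
  aFrob := Matrix.GeneralLinearGroup.scalar (Fin n) a

/-- The automorphism `θ̂ : (x_1, …, x_m) ↦ (x_2, …, x_m, x_1)` of `GL(n, ℂ)^m`; the index
`i : Fin m` stands for the position `i + 1`. -/
def shift (n m : ℕ) : MulAut (Fin m → GL (Fin n) ℂ) where
  toFun x := fun i => x (finRotate m i)
  invFun x := fun i => x ((finRotate m).symm i)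
  left_inv x := funext fun i => congrArg x ((finRotate m).apply_symm_apply i)
  right_inv x := funext fun i => congrArg x ((finRotate m).symm_apply_apply i)
  map_mul' _ _ := rfl

theorem shift_pow_apply (n m k : ℕ) (x : Fin m → GL (Fin n) ℂ) (i : Fin m) :
    (shift n m ^ k) x i = x ((finRotate m ^ k) i) := by
  induction k generalizing x i with
  | zero => rfl
  | succ k ih => rw [pow_succ, MulAut.mul_apply, ih, pow_succ']; rfl

theorem finRotate_pow_self (m : ℕ) : finRotate m ^ m = 1 := by
  match m with
  | 0 => rfl
  | 1 => exact Subsingleton.elim _ _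
  | m + 2 =>
    have h : orderOf (finRotate (m + 2)) = m + 2 := by
      rw [← Equiv.Perm.lcm_cycleType, cycleType_finRotate, Multiset.lcm_singleton]
      simp
    exact orderOf_dvd_iff_pow_eq_one.mp h.dvd

theorem shift_pow_self (n m : ℕ) : shift n m ^ m = 1 := by
  ext1 x
  funext i
  rw [shift_pow_apply, finRotate_pow_self]
  rfl

/-- The element `(1, …, 1, x)` of `GL(n, ℂ)^m`. -/
def lastEntry {n : ℕ} (m : ℕ) (x : GL (Fin n) ℂ) : Fin m → GL (Fin n) ℂ :=
  fun i => if (i : ℕ) + 1 = m then x else 1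

/-- The element `(h, …, h, h s, …, h s)` of `GL(n, ℂ)^m`, where `h` occurs `a mod m` times. -/
def hVector {n : ℕ} (m : ℕ) (a : ℤ) (h s : GL (Fin n) ℂ) : Fin m → GL (Fin n) ℂ :=
  fun i => if ((i : ℕ) : ℤ) < a % (m : ℤ) then h else h * s

variable {F}

theorem orderOf_shift_dvd {E : IntermediateField F (AlgebraicClosure F)}
    [FiniteDimensional F E] [IsGalois F E] {m : ℕ} (hm : Module.finrank F E = m)
    {θ : E ≃ₐ[F] E} (hθ : ∀ τ : E ≃ₐ[F] E, τ ∈ Subgroup.zpowers θ) (n : ℕ) :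
    orderOf (shift n m) ∣ orderOf θ := by
  have h : orderOf θ = m := by
    rw [orderOf_eq_card_of_forall_mem_zpowers hθ, ← hm, IsGalois.card_aut_eq_finrank]
  rw [h]
  exact orderOf_dvd_of_pow_eq_one (shift_pow_self n m)

variable {E : IntermediateField F (AlgebraicClosure F)} [FiniteDimensional F E] [IsGalois F E]
  {m : ℕ} (hm : Module.finrank F E = m)
  {θ : E ≃ₐ[F] E} (hθ : ∀ τ : E ≃ₐ[F] E, τ ∈ Subgroup.zpowers θ)

/-- The dual side of `(G̃, ω_E)` for `G = Res_{E/F} GL(n)`, `G̃ = G θ`: `Ĝ = GL(n, ℂ)^m` with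
`θ̂ (x_1, …, x_m) = (x_2, …, x_m, x_1)`. The group `W_F` acts through `Gal(E/F)`, the
generator `θ` of `Gal(E/F)` acting by `θ̂`. The class corresponding to `ω_E` has the value
`(1, …, 1, a)` at Frobenius. -/
def dualG (n : ℕ) (a : ℂˣ) : DualSide F (Fin m → GL (Fin n) ℂ) where
  torus := Subgroup.pi Set.univ fun _ => diagTorus n
  coeffs := Set.range fun (p : Fin m × Fin n × Fin n) (x : Fin m → GL (Fin n) ℂ) =>
    (x p.1 : Matrix (Fin n) (Fin n) ℂ) p.2.1 p.2.2
  galAct := (monoidHomOfForallMemZpowers hθ (orderOf_shift_dvd hm hθ n)).comp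
    ((AlgEquiv.restrictNormalHom (F := F) (K₁ := AlgebraicClosure F) E).comp
      (weilGroup F).subtype)
  theta := shift n m
  aFrob := lastEntry m (Matrix.GeneralLinearGroup.scalar (Fin n) a)

/-- The triple `𝐓' = (T', 𝒯', s̃)` constructed from `𝐓'_H = (T'_H, 𝒯'_H, s_H)` and from an
element `(h_H, φ) ∈ 𝒯'_H`: `T' = T'_H`, `s̃ = (1, …, 1, s_H) θ̂`, and `𝒯'` is the subgroup of
`ᴸG` generated by `Ĝ_s̃`, `I_F` and `(h, φ)`, where
`h = (h_H, …, h_H, h_H s_H, …, h_H s_H)` with `h_H` occurring `a mod m` times. -/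
def construct {n : ℕ} {α : ℂˣ} (a : ℤ) (T : (dualH F n α).Triple) (h : GL (Fin n) ℂ)
    (φ : weilGroup F) : (dualG hm hθ n α).Triple where
  torus := T.torus
  group := Subgroup.closure
    (SemidirectProduct.inl '' ((dualG hm hθ n α).connCentralizer (lastEntry m T.s) :
        Set (Fin m → GL (Fin n) ℂ)) ∪
      {g | ∃ w : weilGroup F, (w : GaloisGroup F) ∈ inertiaGroup F ∧ g = ⟨1, w⟩} ∪
      {⟨hVector m a h T.s, φ⟩})
  s := lastEntry m T.s

end GLn

end Endoscopy

end

open Endoscopy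

noncomputable section

namespace Endoscopy

/-! ### Inertia, Frobenius elements and the valuation of the Weil group. -/

section Galois

variable {F : Type*} [Field F] [ValuativeRel F] [TopologicalSpace F]
  [IsNonarchimedeanLocalField F]

/-! Each of the two sets of classes has at most one element, and the first is nonempty as soon as
the second is. Since the construction produces data, it then gives a well-defined map, which is
automatically bijective.

A datum contains `I_F`, so it is generated by `Ĝ_s̃`, `I_F` and one element `(h, φ)` above a
Frobenius element (`Triple.IsDatum.group_eq`). All conditions reduce to conditions on `(s, h)`,
collected in `IsFrobDatum`; conversely these give back a datum (`IsFrobDatum.isDatum`).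

For `H` the cocycle condition reads `s h s⁻¹ = α h`, where `α = ω ϖ` has order exactly `n`. If `v`
is an eigenvector of `s` with eigenvalue `c`, the vectors `h ^ i v` have the distinct eigenvalues `c
α ^ i` and form a basis, which `h` permutes cyclically up to scalars. Hence `(s, h)` is unique up to
conjugation and scalars (`exists_conj_of_twist`). Scalars do not change the isomorphism class: those
on `s` are central, those on `h` lie in `Ĝ_s̃`. So all data for `H` are isomorphic (`dualH_iso`).

For `G̃`, twisted conjugation brings `s̃` to `(1, …, 1, s) θ̂`, and a central translation removes
the coboundary from the cocycle condition. The condition can then be solved entry by entry: its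
solutions are exactly the vectors `hVector` with `s h s⁻¹ = α h` (`hVector_cocycle`,
`exists_eq_hVector`). The connected centralizer, the invariants and the center all lie in the
diagonal copy of `GL(n, ℂ)`, so the remaining conditions agree for `H` and `G̃`. This transfers data
in both directions, and uniqueness of `(s, h)` gives uniqueness for `G̃` (`dualG_iso`), an `m`-th
root absorbing the scalar on `s`. -/

theorem smul_mem_maxIdealBar (σ : GaloisGroup F) {x : IntegersBar F} (hx : x ∈ maxIdealBar F) :
    σ • x ∈ maxIdealBar F := by
  obtain ⟨k, hk⟩ := hx
  refine ⟨k, ?_⟩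
  rw [← smul_pow']
  generalize x ^ k = y at hk
  induction hk using Submodule.span_induction with
  | mem y hy =>
    obtain ⟨r, hr, rfl⟩ := hy
    rw [smul_algebraMap]
    exact Ideal.mem_map_of_mem _ hr
  | zero => rw [smul_zero]; exact Submodule.zero_mem _
  | add y z _ _ hy hz => rw [smul_add]; exact Submodule.add_mem _ hy hz
  | smul c y _ hy => rw [smul_eq_mul, smul_mul']; exact Ideal.mul_mem_left _ _ hy

/-- Lying over: along an injective integral extension a proper ideal generates a proper ideal. -/
theorem maxIdealBar_ne_top : maxIdealBar F ≠ ⊤ := by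
  rw [maxIdealBar, Ne, Ideal.radical_eq_top, Ideal.map_eq_top_iff]
  · exact (IsLocalRing.maximalIdeal.isMaximal _).ne_top
  · refine fun x y hxy => Subtype.ext ?_
    have := congrArg (fun z : IntegersBar F => (z : AlgebraicClosure F)) hxy
    exact (algebraMap F (AlgebraicClosure F)).injective this
  · exact algebraMap_isIntegral_iff.mpr inferInstance

theorem IsFrobeniusElt.inv_mul_mem {φ ψ : GaloisGroup F} (hφ : IsFrobeniusElt F φ)
    (hψ : IsFrobeniusElt F ψ) : φ⁻¹ * ψ ∈ inertiaGroup F := by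
  intro x
  have h := smul_mem_maxIdealBar φ⁻¹ (sub_mem (hψ x) (hφ x))
  rwa [sub_sub_sub_cancel_right, smul_sub, smul_smul, smul_smul, inv_mul_cancel, one_smul] at h

instance inertiaGroup_normal : (inertiaGroup F).Normal := by
  refine ⟨fun σ hσ τ x => ?_⟩
  have h := smul_mem_maxIdealBar τ (hσ (τ⁻¹ • x))
  rwa [smul_sub, smul_smul, smul_smul, smul_smul, mul_inv_cancel, one_smul] at h

/-- Two Frobenius elements differ by inertia, which is normal, so `W_F` is the product of the powers
of `φ` and `I_F`. -/
theorem exists_zpow_inv_mul_mem {φ : weilGroup F} (hφ : IsFrobeniusElt F (φ : GaloisGroup F))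
    (w : weilGroup F) :
    ∃ k : ℤ, (((φ ^ k)⁻¹ * w : weilGroup F) : GaloisGroup F) ∈ inertiaGroup F := by
  have hle : weilGroup F ≤ Subgroup.zpowers (φ : GaloisGroup F) ⊔ inertiaGroup F := by
    refine sup_le le_sup_right ((Subgroup.closure_le _).mpr fun ψ hψ => ?_)
    rw [SetLike.mem_coe, Subgroup.mem_sup_of_normal_right]
    exact ⟨φ, Subgroup.mem_zpowers _, _, hφ.inv_mul_mem hψ, mul_inv_cancel_left _ _⟩
  obtain ⟨y, ⟨k, rfl⟩, z, hz, hw⟩ := Subgroup.mem_sup_of_normal_right.mp (hle w.2)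
  exact ⟨k, by rw [Subgroup.coe_mul, ← hw]; simpa using hz⟩

theorem IsFrobeniusElt.pow_smul_sub_mem {φ : GaloisGroup F} (hφ : IsFrobeniusElt F φ) (k : ℕ)
    (x : IntegersBar F) : φ ^ k • x - x ^ Nat.card 𝓀[F] ^ k ∈ maxIdealBar F := by
  induction k with
  | zero => simp
  | succ k ih =>
    have h := add_mem (smul_mem_maxIdealBar φ ih) (hφ (x ^ Nat.card 𝓀[F] ^ k))
    rwa [smul_sub, sub_add_sub_cancel, smul_smul, ← pow_succ', ← pow_mul, ← pow_succ] at h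

theorem card_mem_maxIdealBar : ((Nat.card 𝓀[F] : ℕ) : IntegersBar F) ∈ maxIdealBar F := by
  refine Ideal.le_radical ?_
  rw [← map_natCast (algebraMap 𝒪[F] (IntegersBar F))]
  refine Ideal.mem_map_of_mem _ ?_
  rw [← IsLocalRing.residue_eq_zero_iff, map_natCast]
  have := Fintype.ofFinite 𝓀[F]
  rw [Nat.card_eq_fintype_card]
  exact Nat.cast_card_eq_zero _

/-- A root of unity of order prime to the residue characteristic which is congruent to `1` is
equal to `1`. -/
theorem eq_one_of_sub_one_mem_maxIdealBar {k : ℕ} {x : IntegersBar F}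
    (hx : x ^ (Nat.card 𝓀[F] ^ (k + 1) - 1) = 1) (h : x - 1 ∈ maxIdealBar F) : x = 1 := by
  by_contra hne
  set N := Nat.card 𝓀[F] ^ (k + 1) - 1 with hN
  -- If `x ≠ 1` this sum vanishes, while modulo the ideal it equals `N`. Then both `N` and `N + 1`,
  -- a power of `q`, lie in the ideal, which would contain `1`.
  have hsum : ∑ i ∈ Finset.range N, x ^ i = 0 := by
    have h1 := geom_sum_mul x N
    rw [hx, sub_self] at h1
    exact (mul_eq_zero.mp h1).resolve_right (sub_ne_zero.mpr hne)
  have hN1 : (N : IntegersBar F) ∈ maxIdealBar F := by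
    have h2 : (∑ i ∈ Finset.range N, (1 - x ^ i)) ∈ maxIdealBar F := by
      refine sum_mem fun i _ => ?_
      rw [← neg_sub, neg_mem_iff, ← geom_sum_mul x i]
      exact Ideal.mul_mem_left _ _ h
    rw [Finset.sum_sub_distrib, hsum] at h2
    simpa using h2
  have hq : ((Nat.card 𝓀[F] ^ (k + 1) : ℕ) : IntegersBar F) ∈ maxIdealBar F := by
    rw [Nat.cast_pow]
    exact Ideal.pow_mem_of_mem _ card_mem_maxIdealBar _ k.succ_pos
  have hpos : 0 < Nat.card 𝓀[F] ^ (k + 1) := pow_pos Nat.card_pos _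
  have hcast : ((Nat.card 𝓀[F] ^ (k + 1) : ℕ) : IntegersBar F) = N + 1 := by
    rw [← Nat.cast_succ, hN, Nat.succ_eq_add_one, Nat.sub_add_cancel hpos]
  refine maxIdealBar_ne_top (F := F) ((Ideal.eq_top_iff_one _).mpr ?_)
  have := sub_mem hq hN1
  rwa [hcast, add_sub_cancel_left] at this

/-- Tested on a primitive root of unity `ζ` of order `q ^ (k + 1) - 1`: if `φ ^ k` were inertial, `ζ
^ (q ^ k - 1)` would be congruent to `1`, hence equal to `1`, although `0 < q ^ k - 1 < q ^ (k + 1)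
- 1`. The exponent `k + 1` matters, since order `q ^ k - 1` would give no contradiction. -/
theorem IsFrobeniusElt.pow_notMem [CharZero F] {φ : GaloisGroup F} (hφ : IsFrobeniusElt F φ)
    {k : ℕ} (hk : 0 < k) : φ ^ k ∉ inertiaGroup F := by
  intro hmem
  set q := Nat.card 𝓀[F] with hq
  have hq1 : 1 < q := Finite.one_lt_card
  have hqk : 1 < q ^ k := Nat.one_lt_pow hk.ne' hq1
  have hlt : q ^ k < q ^ (k + 1) := Nat.pow_lt_pow_right hq1 k.lt_succ_self
  have hN : NeZero (q ^ (k + 1) - 1) := ⟨by omega⟩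
  have : CharZero (AlgebraicClosure F) := charZero_of_injective_algebraMap
    (algebraMap F (AlgebraicClosure F)).injective
  have hN' : NeZero ((q ^ (k + 1) - 1 : ℕ) : AlgebraicClosure F) := NeZero.charZero
  obtain ⟨ζ, hζ⟩ := HasEnoughRootsOfUnity.exists_primitiveRoot (AlgebraicClosure F)
    (q ^ (k + 1) - 1)
  have hint : IsIntegral 𝒪[F] ζ := hζ.isIntegral (NeZero.pos _) |>.tower_top
  let z : IntegersBar F := ⟨ζ, hint⟩
  have hz : IsPrimitiveRoot z (q ^ (k + 1) - 1) :=
    IsPrimitiveRoot.of_map_of_injective (f := (integralClosure 𝒪[F] (AlgebraicClosure F)).subtype)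
      hζ Subtype.val_injective
  have h1 : z ^ q ^ k - z ∈ maxIdealBar F := by
    have := sub_mem (hmem z) (hφ.pow_smul_sub_mem k z)
    rwa [sub_sub_sub_cancel_left] at this
  have h2 : z ^ (q ^ k - 1) - 1 ∈ maxIdealBar F := by
    have h3 := Ideal.mul_mem_left _ (z ^ (q ^ (k + 1) - 1 - 1)) h1
    have h4 : z ^ (q ^ (k + 1) - 1 - 1) * z = 1 := by
      rw [← pow_succ, Nat.sub_add_cancel (by omega), hz.pow_eq_one]
    have h5 : z ^ q ^ k = z * z ^ (q ^ k - 1) := by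
      rw [← pow_succ', Nat.sub_add_cancel hqk.le]
    rwa [mul_sub, h5, ← mul_assoc, h4, one_mul] at h3
  have h6 := eq_one_of_sub_one_mem_maxIdealBar (k := k) (x := z ^ (q ^ k - 1))
    (by rw [← pow_mul, mul_comm, pow_mul, hz.pow_eq_one, one_pow]) h2
  have h7 := Nat.le_of_dvd (by omega) ((hz.pow_eq_one_iff_dvd _).mp h6)
  omega

theorem IsFrobeniusElt.zpow_mem_iff [CharZero F] {φ : GaloisGroup F} (hφ : IsFrobeniusElt F φ)
    {k : ℤ} : φ ^ k ∈ inertiaGroup F ↔ k = 0 := by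
  refine ⟨fun h => ?_, fun h => by rw [h, zpow_zero]; exact one_mem _⟩
  by_contra hk
  have hpos : 0 < k.natAbs := Int.natAbs_pos.mpr hk
  refine hφ.pow_notMem hpos ?_
  rcases Int.natAbs_eq k with h' | h' <;> rw [h'] at h
  · rwa [zpow_natCast] at h
  · rwa [zpow_neg, inv_mem_iff, zpow_natCast] at h

/-- The valuation `W_F → ℤ`, normalized by a Frobenius element `φ`. -/
theorem exists_weil_valuation [CharZero F] {φ : weilGroup F}
    (hφ : IsFrobeniusElt F (φ : GaloisGroup F)) :
    ∃ v : weilGroup F →* Multiplicative ℤ,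
      (∀ w, (((φ ^ (v w).toAdd)⁻¹ * w : weilGroup F) : GaloisGroup F) ∈ inertiaGroup F) ∧
      (∀ w : weilGroup F, (w : GaloisGroup F) ∈ inertiaGroup F → v w = 1) ∧
      (∀ w : weilGroup F, IsFrobeniusElt F (w : GaloisGroup F) → v w = Multiplicative.ofAdd 1) := by
  choose k hk using exists_zpow_inv_mul_mem hφ
  -- Uniqueness of the exponent, which holds because no nonzero power of `φ` is inertial, makes `k`
  -- additive and computes it on inertia and Frobenius elements.
  have huniq : ∀ (w : weilGroup F) (j : ℤ),
      (((φ ^ j)⁻¹ * w : weilGroup F) : GaloisGroup F) ∈ inertiaGroup F → k w = j := by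
    intro w j hj
    have h := mul_mem (hk w) (inv_mem hj)
    rw [← Subgroup.coe_inv, ← Subgroup.coe_mul] at h
    have h' : (φ ^ k w)⁻¹ * w * ((φ ^ j)⁻¹ * w)⁻¹ = φ ^ (j - k w) := by
      rw [sub_eq_neg_add, zpow_add]; group
    rw [h', Subgroup.coe_zpow, hφ.zpow_mem_iff] at h
    omega
  refine ⟨MonoidHom.mk' (fun w => Multiplicative.ofAdd (k w)) fun w w' => ?_, hk,
    fun w hw => ?_, fun w hw => ?_⟩
  · rw [← ofAdd_add]
    congr 1
    apply huniq
    have h := mul_mem (inertiaGroup_normal.conj_mem _ (hk w) ((φ : GaloisGroup F) ^ (k w'))⁻¹)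
      (hk w')
    convert h using 1
    rw [add_comm, zpow_add]
    push_cast
    group
  · exact congrArg Multiplicative.ofAdd (huniq w 0 (by simpa using hw))
  · exact congrArg Multiplicative.ofAdd (huniq w 1 (by simpa using hφ.inv_mul_mem hw))

/-- An integral element is a unit times a power of `ϖ`, and any element or its inverse is integral,
so `ω` is determined by `ω ϖ`. -/
theorem orderOf_apply_uniformizer {ω : Fˣ →* ℂˣ}
    (hω_unr : ∀ u : 𝒪[F]ˣ, ω (Units.map (Subring.subtype 𝒪[F]).toMonoidHom u) = 1)
    {ϖ : Fˣ} (hϖ : ∃ p : 𝒪[F], Irreducible p ∧ (p : F) = ϖ) :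
    orderOf (ω ϖ) = orderOf ω := by
  refine orderOf_eq_orderOf_iff.mpr fun k => ⟨fun h => ?_, fun h => ?_⟩
  · obtain ⟨p, hp, hpϖ⟩ := hϖ
    have key : ∀ x : Fˣ, (x : F) ∈ 𝒪[F] → ω x ^ k = 1 := by
      intro x hx
      obtain ⟨j, u, hu⟩ := IsDiscreteValuationRing.eq_unit_mul_pow_irreducible
        (x := (⟨x, hx⟩ : 𝒪[F])) (fun h0 => x.ne_zero (congrArg Subtype.val h0)) hp
      have hx' : x = Units.map (Subring.subtype 𝒪[F]).toMonoidHom u * ϖ ^ j := by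
        refine Units.ext ?_
        have := congrArg Subtype.val hu
        simpa [hpϖ] using this
      rw [hx', map_mul, hω_unr, one_mul, map_pow, ← pow_mul, mul_comm, pow_mul, h, one_pow]
    refine MonoidHom.ext fun x => ?_
    rw [MonoidHom.pow_apply, MonoidHom.one_apply]
    rcases le_total (valuation F (x : F)) 1 with hx | hx
    · exact key x hx
    · have h1 := key x⁻¹ (by
        change valuation F ((x⁻¹ : Fˣ) : F) ≤ 1
        rw [Units.val_inv_eq_inv_val, map_inv₀]
        exact inv_le_one_of_one_le₀ hx)
      rwa [map_inv, inv_pow, inv_eq_one] at h1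
  · rw [← MonoidHom.pow_apply, h, MonoidHom.one_apply]

end Galois

/-! ### Neutral components and their transport. -/

section Neutral

variable {X : Type*} [Group X] [TopologicalSpace X] [IsTopologicalGroup X]

theorem coe_neutral (S : Subgroup X) :
    (neutral S : Set X) = connectedComponentIn (S : Set X) 1 := by
  rw [connectedComponentIn_eq_image (one_mem S)]
  rfl

theorem neutral_le (S : Subgroup X) : neutral S ≤ S := Subgroup.map_subtype_le _

theorem mem_neutral_of_continuous {S : Subgroup X} {f : ℂ → X} (hf : Continuous f)
    (h0 : f 0 = 1) (hS : ∀ z, f z ∈ S) (z : ℂ) : f z ∈ neutral S := by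
  rw [← SetLike.mem_coe, coe_neutral]
  refine (isPreconnected_range hf).subset_connectedComponentIn ⟨0, h0⟩ ?_ ⟨z, rfl⟩
  rintro _ ⟨w, rfl⟩
  exact hS w

/-- The continuous retraction `g` carries a connected subset of the image back to a connected subset
of `S`. Used for conjugations and for the diagonal embedding. -/
theorem neutral_map {Y : Type*} [Group Y] [TopologicalSpace Y] [IsTopologicalGroup Y]
    {f : X →* Y} {g : Y →* X} (hf : Continuous f) (hg : Continuous g)
    (hgf : ∀ x, g (f x) = x) (S : Subgroup X) : neutral (S.map f) = (neutral S).map f := by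
  apply SetLike.coe_injective
  rw [Subgroup.coe_map, coe_neutral, coe_neutral]
  apply Set.Subset.antisymm
  · intro y hy
    have hpre : IsPreconnected (g '' connectedComponentIn (S.map f : Set Y) 1) :=
      isPreconnected_connectedComponentIn.image _ hg.continuousOn
    have hsub : g '' connectedComponentIn (S.map f : Set Y) 1 ⊆ S := by
      rintro _ ⟨z, hz, rfl⟩
      obtain ⟨x, hx, rfl⟩ := connectedComponentIn_subset _ _ hz
      rwa [hgf]
    refine ⟨g y, hpre.subset_connectedComponentIn
      ⟨1, mem_connectedComponentIn (one_mem (S.map f)), map_one g⟩ hsub ⟨y, hy, rfl⟩, ?_⟩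
    obtain ⟨x, _, rfl⟩ := connectedComponentIn_subset _ _ hy
    rw [hgf]
  · refine (isPreconnected_connectedComponentIn.image _
      hf.continuousOn).subset_connectedComponentIn
      ⟨1, mem_connectedComponentIn (one_mem S), map_one f⟩ ?_
    exact Set.image_mono (connectedComponentIn_subset _ _)

theorem neutral_map_conj (x : X) (S : Subgroup X) :
    neutral (S.map (MulAut.conj x).toMonoidHom) =
      (neutral S).map (MulAut.conj x).toMonoidHom := by
  refine neutral_map (g := (MulAut.conj x⁻¹).toMonoidHom) ?_ ?_ ?_ S
  · change Continuous fun y => x * y * x⁻¹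
    fun_prop
  · change Continuous fun y => x⁻¹ * y * x⁻¹⁻¹
    fun_prop
  · intro y
    simp [mul_assoc]

end Neutral

/-! ### The Galois action on the dual torus. -/

section Torus

variable {F : Type*} [Field F] [ValuativeRel F] [TopologicalSpace F]
  [IsNonarchimedeanLocalField F]

theorem FTorus.dualAct_mul (T : FTorus F) (σ τ : GaloisGroup F) (t : Fin T.rank → ℂˣ) :
    T.dualAct (σ * τ) t = T.dualAct σ (T.dualAct τ t) := by
  funext i
  simp only [FTorus.dualAct, map_mul, Units.val_mul, Matrix.mul_apply]
  simp_rw [← Finset.prod_zpow, ← zpow_mul]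
  rw [Finset.prod_comm]
  refine Finset.prod_congr rfl fun j _ => ?_
  induction (Finset.univ : Finset (Fin T.rank)) using Finset.induction_on with
  | empty => simp
  | insert k s hk ih => rw [Finset.sum_insert hk, Finset.prod_insert hk, zpow_add, ih, mul_comm
      ((T.act σ : Matrix (Fin T.rank) (Fin T.rank) ℤ) i k)]

theorem FTorus.dualAct_one (T : FTorus F) (t : Fin T.rank → ℂˣ) : T.dualAct 1 t = t := by
  funext i
  simp only [FTorus.dualAct, map_one, Units.val_one]
  rw [Finset.prod_eq_single i]
  · simp
  · intro j _ hj
    rw [Matrix.one_apply_ne hj.symm, zpow_zero]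
  · simp

end Torus

/-! ### Endoscopic data described by a single element above Frobenius. -/

section Data

variable {F : Type*} [Field F] [ValuativeRel F] [TopologicalSpace F]
  [IsNonarchimedeanLocalField F]
variable {X : Type} [Group X] [TopologicalSpace X] [IsTopologicalGroup X]

namespace DualSide

variable {D : DualSide F X}

/-- The action of `W_F` on `Ĝ` is unramified and commutes with `θ̂`, and `coeffs` behaves like a
space of matrix coefficients. -/
structure IsUnramified (D : DualSide F X) : Prop where
  galAct_inertia : ∀ w : weilGroup F, (w : GaloisGroup F) ∈ inertiaGroup F → D.galAct w = 1
  theta_galAct : ∀ w x, D.theta (D.galAct w x) = D.galAct w (D.theta x)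
  aFrob_mem : D.aFrob ∈ Subgroup.center X
  coeffs_conj : ∀ (r : ℕ) (f : (Fin r → ℂˣ) → X) (x : X),
    (∀ u ∈ D.coeffs, (fun t => u (f t)) ∈ laurent r) →
    ∀ u ∈ D.coeffs, (fun t => u (x * f t * x⁻¹)) ∈ laurent r

theorem mulAut_mem_center (f : MulAut X) {z : X} (hz : z ∈ Subgroup.center X) :
    f z ∈ Subgroup.center X := by
  rw [Subgroup.mem_center_iff] at hz ⊢
  intro x
  have h := congrArg f (hz (f⁻¹ x))
  simpa using h

variable (D) in
/-- The centralizer of `s θ̂` in `Ĝ`. -/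
def twistedCentralizer (s : X) : Subgroup X :=
  MonoidHom.eqLocus (MulAut.conj s * D.theta).toMonoidHom (MonoidHom.id X)

theorem mem_twistedCentralizer {s y : X} :
    y ∈ D.twistedCentralizer s ↔ s * D.theta y * s⁻¹ = y := Iff.rfl

theorem connCentralizer_eq (s : X) : D.connCentralizer s = neutral (D.twistedCentralizer s) := rfl

theorem twisted_eq_of_mem {s y : X} (hy : y ∈ D.connCentralizer s) :
    s * D.theta y * s⁻¹ = y :=
  mem_twistedCentralizer.mp (neutral_le _ hy)

/-- Twisted conjugation by `x` is conjugation of `s̃` in `Ĝ ⋊ ⟨θ̂⟩`, and a central factor does not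
change `Int(s̃)`. -/
theorem connCentralizer_conj (s x z : X) (hz : z ∈ Subgroup.center X) :
    D.connCentralizer (z * (x * s * (D.theta x)⁻¹)) =
      (D.connCentralizer s).map (MulAut.conj x).toMonoidHom := by
  rw [connCentralizer_eq, connCentralizer_eq, ← neutral_map_conj]
  congr 1
  ext y
  rw [mem_twistedCentralizer, Subgroup.mem_map]
  have hzc : ∀ u, z * u * z⁻¹ = u := fun u => by
    rw [← Subgroup.mem_center_iff.mp hz u, mul_inv_cancel_right]
  have hexp : z * (x * s * (D.theta x)⁻¹) * D.theta y * (z * (x * s * (D.theta x)⁻¹))⁻¹ =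
      x * (s * D.theta (x⁻¹ * y * x) * s⁻¹) * x⁻¹ := by
    rw [← hzc (x * (s * D.theta (x⁻¹ * y * x) * s⁻¹) * x⁻¹), map_mul, map_mul, map_inv]
    group
  rw [hexp]
  constructor
  · intro h
    refine ⟨x⁻¹ * y * x, ?_, ?_⟩
    · rw [mem_twistedCentralizer]
      have h' := congrArg (fun u => x⁻¹ * u * x) h
      rw [← h', h]
      conv_rhs => rw [← h]
      group
    · simp [mul_assoc]
  · rintro ⟨u, hu, rfl⟩
    rw [mem_twistedCentralizer] at hu
    simp only [MulEquiv.toMonoidHom_eq_coe, MonoidHom.coe_coe, MulAut.conj_apply]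
    have : x⁻¹ * (x * u * x⁻¹) * x = u := by group
    rw [this, hu]

variable (D) in
/-- The subgroup of `ᴸG` generated by `Ĝ_s̃`, `I_F` and `(h, φ)`. -/
def frobGroup (s h : X) (φ : weilGroup F) : Subgroup D.LGroup :=
  Subgroup.closure
    (SemidirectProduct.inl '' (D.connCentralizer s : Set X) ∪
      {g | ∃ w : weilGroup F, (w : GaloisGroup F) ∈ inertiaGroup F ∧ g = ⟨1, w⟩} ∪
      {⟨h, φ⟩})

theorem inl_mem_frobGroup {s h y : X} {φ : weilGroup F} (hy : y ∈ D.connCentralizer s) :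
    (SemidirectProduct.inl y : D.LGroup) ∈ D.frobGroup s h φ :=
  Subgroup.subset_closure (Or.inl (Or.inl ⟨y, hy, rfl⟩))

theorem inertia_mem_frobGroup {s h : X} {φ w : weilGroup F}
    (hw : (w : GaloisGroup F) ∈ inertiaGroup F) :
    (⟨1, w⟩ : D.LGroup) ∈ D.frobGroup s h φ :=
  Subgroup.subset_closure (Or.inl (Or.inr ⟨w, hw, rfl⟩))

theorem frob_mem_frobGroup {s h : X} {φ : weilGroup F} :
    (⟨h, φ⟩ : D.LGroup) ∈ D.frobGroup s h φ :=
  Subgroup.subset_closure (Or.inr rfl)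

theorem frobGroup_le {s h : X} {φ : weilGroup F} {S : Subgroup D.LGroup}
    (h₁ : ∀ y ∈ D.connCentralizer s, (⟨y, 1⟩ : D.LGroup) ∈ S)
    (h₂ : ∀ w : weilGroup F, (w : GaloisGroup F) ∈ inertiaGroup F → (⟨1, w⟩ : D.LGroup) ∈ S)
    (h₃ : (⟨h, φ⟩ : D.LGroup) ∈ S) : D.frobGroup s h φ ≤ S := by
  refine (Subgroup.closure_le _).mpr ?_
  rintro _ ((⟨y, hy, rfl⟩ | ⟨w, hw, rfl⟩) | rfl)
  exacts [h₁ y hy, h₂ w hw, h₃]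

variable (D) in
/-- The elements of `Ĝ_s̃` which commute with `(h, φ)`. -/
def frobInvariants (s h : X) (φ : weilGroup F) : Subgroup X :=
  D.connCentralizer s ⊓
    MonoidHom.eqLocus (MulAut.conj h * D.galAct φ).toMonoidHom (MonoidHom.id X)

theorem mem_frobInvariants {s h y : X} {φ : weilGroup F} :
    y ∈ D.frobInvariants s h φ ↔
      y ∈ D.connCentralizer s ∧ h * D.galAct φ y * h⁻¹ = y := Iff.rfl

variable (D) in
/-- The conditions on `T'`, `s̃` and `(h, φ)` for `Ĝ_s̃`, `I_F` and `(h, φ)` to generate an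
endoscopic datum, apart from the semisimplicity of `s̃`. -/
structure IsFrobDatum (T : FTorus F) (s h : X) (φ : weilGroup F) : Prop where
  dual : ∃ ι : (Fin T.rank → ℂˣ) →* X,
    Function.Injective ι ∧ ι.range = D.connCentralizer s ∧
    (∀ u ∈ D.coeffs, (fun t => u (ι t)) ∈ laurent T.rank) ∧
    ∀ t, h * D.galAct φ (ι t) * h⁻¹ = ι (T.dualAct (φ : GaloisGroup F) t)
  inertia : ∀ w : weilGroup F, (w : GaloisGroup F) ∈ inertiaGroup F →
    ∀ t, T.dualAct (w : GaloisGroup F) t = t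
  cocycle : ∃ z ∈ Subgroup.center X,
    s * D.theta h * (D.galAct φ s)⁻¹ = h * (z⁻¹ * D.aFrob * D.galAct φ z)
  elliptic : neutral (D.frobInvariants s h φ) = neutral D.centerInvariants

/-- Commutation need only be tested on generators. Those from `Ĝ_s̃` and `I_F` impose nothing, by
commutativity and because the action is unramified; only `(h, φ)` remains. -/
theorem centralizer_frobGroup (hD : D.IsUnramified) {s h : X} {φ : weilGroup F}
    (hcomm : ∀ y ∈ D.connCentralizer s, ∀ y' ∈ D.connCentralizer s, y * y' = y' * y) :
    D.connCentralizer s ⊓ (Subgroup.centralizer (D.frobGroup s h φ : Set D.LGroup)).comap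
      SemidirectProduct.inl = D.frobInvariants s h φ := by
  ext y
  rw [mem_frobInvariants, frobGroup, Subgroup.centralizer_closure, Subgroup.mem_inf,
    Subgroup.mem_comap, Subgroup.mem_centralizer_iff]
  refine and_congr_right fun hy => ?_
  constructor
  · intro H
    have h1 := congrArg SemidirectProduct.left (H _ (Or.inr rfl))
    simp only [SemidirectProduct.mul_left, SemidirectProduct.left_inl,
      SemidirectProduct.right_inl, map_one, MulAut.one_apply] at h1
    rw [h1, mul_inv_cancel_right]
  · rintro H _ ((⟨y', hy', rfl⟩ | ⟨w, hw, rfl⟩) | rfl)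
    · rw [← map_mul, ← map_mul, hcomm y hy y' hy']
    · ext
      · simp [hD.galAct_inertia w hw]
      · simp
    · ext
      · simpa using mul_inv_eq_iff_eq_mul.mp H
      · simp

/-- A datum is generated by `Ĝ_s̃`, `I_F` and any element above a Frobenius element. -/
theorem Triple.IsDatum.group_eq {T : D.Triple} (hT : T.IsDatum) {h : X} {φ : weilGroup F}
    (hφ : IsFrobeniusElt F (φ : GaloisGroup F)) (hh : (⟨h, φ⟩ : D.LGroup) ∈ T.group) :
    T.group = D.frobGroup T.s h φ := by
  apply le_antisymm
  · intro g hg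
    obtain ⟨k, hk⟩ := exists_zpow_inv_mul_mem hφ g.right
    set i := (φ ^ k)⁻¹ * g.right with hi
    -- Removing from `g` the Frobenius power and the inertial part of its image in `W_F` leaves an
    -- element of `𝒯' ∩ Ĝ`, which is `Ĝ_s̃`.
    have hmem : g * (⟨1, i⟩ : D.LGroup)⁻¹ * ((⟨h, φ⟩ : D.LGroup) ^ k)⁻¹ ∈ T.group :=
      mul_mem (mul_mem hg (inv_mem (hT.unramified i hk))) (inv_mem (zpow_mem hh k))
    have hr : (g * (⟨1, i⟩ : D.LGroup)⁻¹ * ((⟨h, φ⟩ : D.LGroup) ^ k)⁻¹).right = 1 := by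
      have hz : ((⟨h, φ⟩ : D.LGroup) ^ k).right = φ ^ k :=
        map_zpow SemidirectProduct.rightHom _ k
      rw [SemidirectProduct.mul_right, SemidirectProduct.mul_right, SemidirectProduct.inv_right,
        SemidirectProduct.inv_right, hz, hi]
      group
    set g' := g * (⟨1, i⟩ : D.LGroup)⁻¹ * ((⟨h, φ⟩ : D.LGroup) ^ k)⁻¹ with hg'
    have hinl : g' = SemidirectProduct.inl g'.left := by
      ext
      · simp
      · simp [hr]
    have hc : g'.left ∈ D.connCentralizer T.s := by
      rw [← hT.inter, Subgroup.mem_comap, ← hinl]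
      exact hmem
    have hgg : g = g' * (⟨h, φ⟩ : D.LGroup) ^ k * (⟨1, i⟩ : D.LGroup) := by
      rw [hg']; group
    rw [hgg, hinl]
    exact mul_mem (mul_mem (inl_mem_frobGroup hc) (zpow_mem frob_mem_frobGroup k))
      (inertia_mem_frobGroup hk)
  · refine frobGroup_le (fun y hy => ?_) hT.unramified hh
    rw [← hT.inter] at hy
    exact hy

theorem Triple.IsDatum.isFrobDatum (hD : D.IsUnramified) {T : D.Triple} (hT : T.IsDatum) {h : X}
    {φ : weilGroup F} (hφ : IsFrobeniusElt F (φ : GaloisGroup F))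
    (hh : (⟨h, φ⟩ : D.LGroup) ∈ T.group) : D.IsFrobDatum T.torus T.s h φ := by
  obtain ⟨ι, hinj, hrange, hcoeff, hact⟩ := hT.dual
  refine ⟨⟨ι, hinj, hrange, hcoeff, hact h φ hh⟩, fun w hw t => hinj ?_, ?_, ?_⟩
  · rw [← hact 1 w (hT.unramified w hw), hD.galAct_inertia w hw]
    simp
  · obtain ⟨c, ⟨hc, _, z, hz, hzc⟩, hcond⟩ := hT.cocycle
    refine ⟨z, hz, ?_⟩
    rw [hcond h φ hh, ← (hzc φ).2 hφ]
    group
  · rw [← hT.elliptic, hT.group_eq hφ hh, centralizer_frobGroup hD]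
    rw [← hrange]
    rintro _ ⟨t, rfl⟩ _ ⟨t', rfl⟩
    rw [← map_mul, ← map_mul, mul_comm]

variable (D) in
/-- The group `Ĝ_s̃ × I_F`. -/
def inertialSubgroup (hD : D.IsUnramified) (s : X) : Subgroup D.LGroup where
  carrier := {g | g.left ∈ D.connCentralizer s ∧ (g.right : GaloisGroup F) ∈ inertiaGroup F}
  one_mem' := ⟨one_mem _, one_mem _⟩
  mul_mem' := fun {g g'} hg hg' => by
    refine ⟨?_, mul_mem hg.2 hg'.2⟩
    rw [SemidirectProduct.mul_left, hD.galAct_inertia _ hg.2]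
    exact mul_mem hg.1 hg'.1
  inv_mem' := fun {g} hg => by
    have h2 : ((g.right⁻¹ : weilGroup F) : GaloisGroup F) ∈ inertiaGroup F := inv_mem hg.2
    refine ⟨?_, h2⟩
    rw [SemidirectProduct.inv_left, hD.galAct_inertia _ h2]
    exact inv_mem hg.1

theorem conj_mem_inertialSubgroup (hD : D.IsUnramified) {s h : X} {φ : weilGroup F}
    (hC : (D.connCentralizer s).map (MulAut.conj h * D.galAct φ).toMonoidHom =
      D.connCentralizer s) :
    (⟨h, φ⟩ : D.LGroup) ∈ Subgroup.normalizer (D.inertialSubgroup hD s : Set D.LGroup) := by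
  rw [Subgroup.mem_normalizer_iff]
  intro g
  have hright : ((⟨h, φ⟩ : D.LGroup) * g * (⟨h, φ⟩ : D.LGroup)⁻¹).right =
      φ * g.right * φ⁻¹ := rfl
  have hI : (g.right : GaloisGroup F) ∈ inertiaGroup F ↔
      ((φ * g.right * φ⁻¹ : weilGroup F) : GaloisGroup F) ∈ inertiaGroup F :=
    ⟨fun hg => inertiaGroup_normal.conj_mem _ hg _, fun hg => by
      have := inertiaGroup_normal.conj_mem _ hg ((φ⁻¹ : weilGroup F) : GaloisGroup F)
      convert this using 1
      push_cast
      group⟩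
  have hleft : (g.right : GaloisGroup F) ∈ inertiaGroup F →
      ((⟨h, φ⟩ : D.LGroup) * g * (⟨h, φ⟩ : D.LGroup)⁻¹).left =
        h * D.galAct φ g.left * h⁻¹ := by
    intro hg
    rw [SemidirectProduct.mul_left, SemidirectProduct.mul_left, SemidirectProduct.inv_left,
      SemidirectProduct.mul_right, map_mul, hD.galAct_inertia _ hg, mul_one, ← MulAut.mul_apply,
      ← map_mul, mul_inv_cancel, map_one, MulAut.one_apply]
  have hmem : ∀ y, h * D.galAct φ y * h⁻¹ ∈ D.connCentralizer s ↔ y ∈ D.connCentralizer s := by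
    intro y
    conv_lhs => rw [← hC]
    exact Subgroup.mem_map_iff_mem (f := (MulAut.conj h * D.galAct φ).toMonoidHom)
      (MulEquiv.injective _)
  change (_ ∧ _) ↔ (_ ∧ _)
  rw [hright, ← hI]
  constructor
  · rintro ⟨h1, h2⟩
    exact ⟨by rw [hleft h2]; exact (hmem _).mpr h1, h2⟩
  · rintro ⟨h1, h2⟩
    exact ⟨(hmem _).mp (by rw [← hleft h2]; exact h1), h2⟩

/-- An unramified cocycle with a given central value at a Frobenius element. -/
theorem exists_cocycle [CharZero F] (hD : D.IsUnramified) {φ : weilGroup F}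
    (hφ : IsFrobeniusElt F (φ : GaloisGroup F)) {z : X} (hz : z ∈ Subgroup.center X) :
    ∃ c : weilGroup F → X, D.IsCocycleInClass c ∧
      (∀ w : weilGroup F, (w : GaloisGroup F) ∈ inertiaGroup F → c w = 1) ∧
      c φ = z⁻¹ * D.aFrob * D.galAct φ z := by
  obtain ⟨v, hv, hvI, hvF⟩ := exists_weil_valuation hφ
  set d := z⁻¹ * D.aFrob * D.galAct φ z with hd
  have hdc : d ∈ Subgroup.center X :=
    mul_mem (mul_mem (inv_mem hz) hD.aFrob_mem) (mulAut_mem_center _ hz)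
  -- The cocycle at `w` is the `Ĝ`-component of `(d, φ) ^ v(w)`. The cocycle relation is then the
  -- group law of `ᴸG`, since `w` and `φ ^ v(w)` act in the same way.
  let g : D.LGroup := ⟨d, φ⟩
  have hgal : ∀ w, D.galAct (φ ^ (v w).toAdd) = D.galAct w := by
    intro w
    have h := hD.galAct_inertia _ (hv w)
    rwa [map_mul, map_inv, inv_mul_eq_one] at h
  have hright : ∀ k : ℤ, (g ^ k).right = φ ^ k := fun k =>
    map_zpow SemidirectProduct.rightHom g k
  have hcent : ∀ k : ℤ, (g ^ k).left ∈ Subgroup.center X := by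
    let Z : Subgroup D.LGroup :=
      { carrier := {g | g.left ∈ Subgroup.center X}
        one_mem' := one_mem (Subgroup.center X)
        mul_mem' := fun {a b} ha hb =>
          mul_mem (S := Subgroup X) ha (mulAut_mem_center (D.galAct a.right) hb)
        inv_mem' := fun {a} ha => mulAut_mem_center _ ((Subgroup.center X).inv_mem ha) }
    exact fun k => zpow_mem (show g ∈ Z from hdc) k
  have hFrob : ∀ w : weilGroup F, IsFrobeniusElt F (w : GaloisGroup F) →
      (g ^ (v w).toAdd).left = d := by
    intro w hw
    rw [hvF w hw, toAdd_ofAdd, zpow_one]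
  refine ⟨fun w => (g ^ (v w).toAdd).left, ⟨fun w => hcent _, fun w w' => ?_, z, hz,
    fun w => ⟨fun hw => ?_, fun hw => ?_⟩⟩, fun w hw => ?_, hFrob φ hφ⟩
  · dsimp only
    rw [map_mul, toAdd_mul, zpow_add, SemidirectProduct.mul_left, hright, hgal]
  · dsimp only
    rw [hvI w hw, hD.galAct_inertia w hw]
    simp
  · have hw' : D.galAct w = D.galAct φ := by
      rw [← hgal w, hvF w hw, toAdd_ofAdd, zpow_one]
    change z * (g ^ (v w).toAdd).left * _ = _
    rw [hFrob w hw, hw', hd]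
    group
  · change (g ^ (v w).toAdd).left = 1
    rw [hvI w hw]
    simp

/-- The elements `(x, w)` of `ᴸG` with `Int(s̃)(x, w) = (x c(w), w)`, for a cocycle `c`. -/
def cocycleSubgroup (hD : D.IsUnramified) (s : X) {c : weilGroup F → X}
    (hc : D.IsCocycleInClass c) : Subgroup D.LGroup where
  carrier := {g | s * D.theta g.left * (D.galAct g.right s)⁻¹ = g.left * c g.right}
  one_mem' := by
    have h1 : c 1 = 1 := by simpa using hc.2.1 1 1
    simp [h1]
  mul_mem' := fun {g g'} hg hg' => by
    rw [Set.mem_ofPred_eq] at hg hg' ⊢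
    rw [SemidirectProduct.mul_left, SemidirectProduct.mul_right, hc.2.1, map_mul D.theta,
      hD.theta_galAct, map_mul D.galAct, MulAut.mul_apply]
    have h1 : s * (D.theta g.left * D.galAct g.right (D.theta g'.left)) *
        (D.galAct g.right (D.galAct g'.right s))⁻¹ =
        (s * D.theta g.left * (D.galAct g.right s)⁻¹) *
          D.galAct g.right (s * D.theta g'.left * (D.galAct g'.right s)⁻¹) := by
      simp only [map_mul, map_inv]; group
    have h2 := Subgroup.mem_center_iff.mp (hc.1 g.right) (D.galAct g.right g'.left)
    rw [h1, hg, hg', map_mul, mul_assoc, ← mul_assoc (c _), ← h2]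
    group
  inv_mem' := fun {g} hg => by
    rw [Set.mem_ofPred_eq] at hg ⊢
    have h1 : c 1 = 1 := by simpa using hc.2.1 1 1
    have h2 := hc.2.1 g.right⁻¹ g.right
    rw [inv_mul_cancel, h1] at h2
    have h3 : D.theta g.left = s⁻¹ * (g.left * c g.right) * D.galAct g.right s := by
      rw [← hg]; group
    have h4 : D.galAct g.right⁻¹ (D.galAct g.right s) = s := by
      rw [← MulAut.mul_apply, ← map_mul, inv_mul_cancel, map_one, MulAut.one_apply]
    have h5 := Subgroup.mem_center_iff.mp
      (mulAut_mem_center (D.galAct g.right⁻¹) (hc.1 g.right)) (D.galAct g.right⁻¹ g.left)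
    rw [SemidirectProduct.inv_left, SemidirectProduct.inv_right, map_inv (D.galAct _),
      map_inv D.theta, hD.theta_galAct, h3, map_mul, map_mul, map_mul, h4, h5, map_inv (D.galAct g.right⁻¹) s]
    rw [eq_inv_of_mul_eq_one_left h2.symm]
    group

/-- Apart from surjectivity onto `W_F`, the conditions on all of `𝒯'` are proved by checking
generators, after showing that the elements with the desired property form a subgroup of `ᴸG` or,
for ellipticity, a centralizer. -/
theorem IsFrobDatum.isDatum [CharZero F] (hD : D.IsUnramified) {T : FTorus F} {s h : X}
    {φ : weilGroup F} (hφ : IsFrobeniusElt F (φ : GaloisGroup F))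
    (hT : D.IsFrobDatum T s h φ) (hs : ∃ x : X, x * s * (D.theta x)⁻¹ ∈ D.torus) :
    (⟨T, D.frobGroup s h φ, s⟩ : D.Triple).IsDatum := by
  obtain ⟨ι, hinj, hrange, hcoeff, hact⟩ := hT.dual
  have hcomm : ∀ y ∈ D.connCentralizer s, ∀ y' ∈ D.connCentralizer s, y * y' = y' * y := by
    rw [← hrange]
    rintro _ ⟨t, rfl⟩ _ ⟨t', rfl⟩
    rw [← map_mul, ← map_mul, mul_comm]
  have hdinv : ∀ (w : GaloisGroup F) t, T.dualAct w (T.dualAct w⁻¹ t) = t := fun w t => by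
    rw [← T.dualAct_mul, mul_inv_cancel, T.dualAct_one]
  have hC : (D.connCentralizer s).map (MulAut.conj h * D.galAct φ).toMonoidHom =
      D.connCentralizer s := by
    rw [← hrange]
    ext y
    constructor
    · rintro ⟨_, ⟨t, rfl⟩, rfl⟩
      exact ⟨_, (hact t).symm⟩
    · rintro ⟨t, rfl⟩
      refine ⟨_, ⟨T.dualAct (φ : GaloisGroup F)⁻¹ t, rfl⟩, ?_⟩
      refine (hact _).trans ?_
      rw [hdinv]
  refine ⟨hs, ?_, fun w => ?_, ⟨ι, hinj, hrange, hcoeff, ?_⟩, ?_, fun w hw =>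
    inertia_mem_frobGroup hw, ?_⟩
  · apply le_antisymm
    · obtain ⟨v, hv, hvI, hvF⟩ := exists_weil_valuation hφ
      let N := D.inertialSubgroup hD s
      have hN : ∀ k : ℤ, (⟨h, φ⟩ : D.LGroup) ^ k ∈ Subgroup.normalizer (N : Set D.LGroup) :=
        fun k => zpow_mem (conj_mem_inertialSubgroup hD hC) k
      -- The elements `y (1, i) (h, φ) ^ k` with `y ∈ Ĝ_s̃` and `i ∈ I_F`. Such an element lying in
      -- `Ĝ` has valuation `0`, so it belongs to `Ĝ_s̃ × I_F` and hence to `Ĝ_s̃`.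
      let R : Subgroup D.LGroup :=
        { carrier := {g | g * ((⟨h, φ⟩ : D.LGroup) ^ (v g.right).toAdd)⁻¹ ∈ N}
          one_mem' := by
            have h1 : (v (1 : D.LGroup).right).toAdd = 0 := by
              rw [SemidirectProduct.one_right, map_one, toAdd_one]
            rw [Set.mem_ofPred_eq, h1]
            simp
          mul_mem' := fun {a b} ha hb => by
            rw [Set.mem_ofPred_eq] at ha hb ⊢
            rw [SemidirectProduct.mul_right, map_mul, toAdd_mul, zpow_add]
            have := mul_mem ha ((Subgroup.mem_normalizer_iff.mp (hN (v a.right).toAdd) _).mp hb)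
            convert this using 1
            group
          inv_mem' := fun {a} ha => by
            rw [Set.mem_ofPred_eq] at ha ⊢
            rw [SemidirectProduct.inv_right, map_inv, toAdd_inv, zpow_neg, inv_inv]
            have := (Subgroup.mem_normalizer_iff.mp (hN (-(v a.right).toAdd)) _).mp (inv_mem ha)
            convert this using 1
            group }
      intro y hy
      have hle : D.frobGroup s h φ ≤ R := by
        refine frobGroup_le (fun y hy => ?_) (fun w hw => ?_) ?_
        · change _ * _ ∈ N
          simpa using (show (⟨y, 1⟩ : D.LGroup) ∈ N from ⟨hy, one_mem _⟩)
        · change _ * _ ∈ N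
          simpa [hvI w hw] using (show (⟨1, w⟩ : D.LGroup) ∈ N from ⟨one_mem _, hw⟩)
        · change _ * _ ∈ N
          simp [hvF φ hφ]
      have hyR : _ * _ ∈ N := hle hy
      rw [SemidirectProduct.right_inl, map_one, toAdd_one, zpow_zero, inv_one, mul_one] at hyR
      exact hyR.1
    · exact fun y hy => inl_mem_frobGroup hy
  · obtain ⟨k, hk⟩ := exists_zpow_inv_mul_mem hφ w
    have hmem := mul_mem (zpow_mem (frob_mem_frobGroup (D := D) (s := s) (h := h) (φ := φ)) k)
      (inertia_mem_frobGroup hk)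
    set g := (⟨h, φ⟩ : D.LGroup) ^ k * ⟨1, (φ ^ k)⁻¹ * w⟩ with hg
    have hr : g.right = w := by
      rw [hg, SemidirectProduct.mul_right]
      have hz : ((⟨h, φ⟩ : D.LGroup) ^ k).right = φ ^ k :=
        map_zpow SemidirectProduct.rightHom _ k
      rw [hz, mul_inv_cancel_left]
    refine ⟨g.left, ?_⟩
    have : (⟨g.left, w⟩ : D.LGroup) = g := by
      ext
      · rfl
      · simp [hr]
    change (⟨g.left, w⟩ : D.LGroup) ∈ _
    rw [this]
    exact hmem
  · let R : Subgroup D.LGroup :=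
      { carrier := {g | ∀ t, g.left * D.galAct g.right (ι t) * g.left⁻¹ =
          ι (T.dualAct (g.right : GaloisGroup F) t)}
        one_mem' := fun t => by simp [T.dualAct_one]
        mul_mem' := fun {a b} ha hb t => by
          rw [SemidirectProduct.mul_left, SemidirectProduct.mul_right, Subgroup.coe_mul,
            T.dualAct_mul, ← ha, ← hb, map_mul D.galAct, MulAut.mul_apply]
          simp only [map_mul, map_inv]
          group
        inv_mem' := fun {a} ha t => by
          have h4 : ∀ u, D.galAct a.right⁻¹ (D.galAct a.right u) = u := fun u => by
            rw [← MulAut.mul_apply, ← map_mul, inv_mul_cancel, map_one, MulAut.one_apply]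
          have h5 := ha (T.dualAct (a.right : GaloisGroup F)⁻¹ t)
          rw [hdinv] at h5
          rw [SemidirectProduct.inv_left, SemidirectProduct.inv_right, ← h5,
            map_inv (D.galAct _), map_mul (D.galAct _), map_mul (D.galAct _), h4,
            map_inv (D.galAct _), Subgroup.coe_inv]
          group }
    intro x w hxw
    refine (frobGroup_le (S := R) (fun y hy t => ?_) (fun w hw t => ?_) hact) hxw
    · simp only [map_one, MulAut.one_apply, Subgroup.coe_one, T.dualAct_one]
      rw [hcomm y hy (ι t) (hrange ▸ ⟨t, rfl⟩), mul_inv_cancel_right]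
    · simp [hD.galAct_inertia w hw, hT.inertia w hw]
  · obtain ⟨z, hz, hcoc⟩ := hT.cocycle
    obtain ⟨c, hc, hcI, hcF⟩ := exists_cocycle hD hφ hz
    refine ⟨c, hc, fun x w hxw => ?_⟩
    refine (frobGroup_le (S := cocycleSubgroup hD s hc) (fun y hy => ?_) (fun w hw => ?_) ?_) hxw
    · have h1 : c 1 = 1 := by simpa using hc.2.1 1 1
      change s * D.theta y * (D.galAct 1 s)⁻¹ = y * c 1
      rw [h1, mul_one, map_one, MulAut.one_apply]
      exact twisted_eq_of_mem hy
    · change s * D.theta 1 * (D.galAct w s)⁻¹ = 1 * c w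
      rw [hD.galAct_inertia w hw, hcI w hw]
      simp
    · change s * D.theta h * (D.galAct φ s)⁻¹ = h * c φ
      rw [hcF, hcoc]
  · rw [centralizer_frobGroup hD hcomm, hT.elliptic]


/-- Conjugation preserves the cocycle, while translating `s̃` by `z` changes it by a coboundary. The
choice `z = z₁` makes the value at Frobenius exactly `aFrob`. -/
theorem cocycle_conj (hD : D.IsUnramified) {s h z z₁ : X} {φ : weilGroup F}
    (hz : z ∈ Subgroup.center X) (hz₁ : z₁ ∈ Subgroup.center X)
    (hcoc : s * D.theta h * (D.galAct φ s)⁻¹ = h * (z₁⁻¹ * D.aFrob * D.galAct φ z₁)) (x : X) :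
    z * (x * s * (D.theta x)⁻¹) * D.theta (x * h * (D.galAct φ x)⁻¹) *
        (D.galAct φ (z * (x * s * (D.theta x)⁻¹)))⁻¹ =
      x * h * (D.galAct φ x)⁻¹ *
        ((z₁ * z⁻¹)⁻¹ * D.aFrob * D.galAct φ (z₁ * z⁻¹)) := by
  have h1 : z * (x * s * (D.theta x)⁻¹) * D.theta (x * h * (D.galAct φ x)⁻¹) *
        (D.galAct φ (z * (x * s * (D.theta x)⁻¹)))⁻¹ =
      z * (x * (s * D.theta h * (D.galAct φ s)⁻¹) * (D.galAct φ x)⁻¹) * (D.galAct φ z)⁻¹ := by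
    simp only [map_mul, map_inv, hD.theta_galAct]
    group
  have hd : z₁⁻¹ * D.aFrob * D.galAct φ z₁ ∈ Subgroup.center X :=
    mul_mem (mul_mem (inv_mem hz₁) hD.aFrob_mem) (mulAut_mem_center _ hz₁)
  have h2 := Subgroup.mem_center_iff.mp hd (D.galAct φ x)⁻¹
  have h3 := Subgroup.mem_center_iff.mp hz (x * h * (D.galAct φ x)⁻¹)
  rw [h1, hcoc]
  calc z * (x * (h * (z₁⁻¹ * D.aFrob * D.galAct φ z₁)) * (D.galAct φ x)⁻¹) * (D.galAct φ z)⁻¹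
      = z * (x * h * ((z₁⁻¹ * D.aFrob * D.galAct φ z₁) * (D.galAct φ x)⁻¹)) *
          (D.galAct φ z)⁻¹ := by group
    _ = (z * (x * h * (D.galAct φ x)⁻¹)) * (z₁⁻¹ * D.aFrob * D.galAct φ z₁) *
          (D.galAct φ z)⁻¹ := by rw [← h2]; group
    _ = _ := by rw [← h3, map_mul, map_inv]; group

theorem centerInvariants_le_center : D.centerInvariants ≤ Subgroup.center X :=
  inf_le_left.trans inf_le_left

theorem frobInvariants_conj (s h x z : X) (hz : z ∈ Subgroup.center X) (φ : weilGroup F) :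
    D.frobInvariants (z * (x * s * (D.theta x)⁻¹)) (x * h * (D.galAct φ x)⁻¹) φ =
      (D.frobInvariants s h φ).map (MulAut.conj x).toMonoidHom := by
  have key : ∀ u, (x * h * (D.galAct φ x)⁻¹) * D.galAct φ (x * u * x⁻¹) *
      (x * h * (D.galAct φ x)⁻¹)⁻¹ = x * (h * D.galAct φ u * h⁻¹) * x⁻¹ := fun u => by
    simp only [map_mul, map_inv]
    group
  ext y
  rw [mem_frobInvariants, connCentralizer_conj s x z hz]
  constructor
  · rintro ⟨⟨u, hu, rfl⟩, hy⟩
    refine ⟨u, mem_frobInvariants.mpr ⟨hu, ?_⟩, rfl⟩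
    have h2 := (key u).symm.trans hy
    exact mul_left_cancel (mul_right_cancel h2)
  · rintro ⟨u, hu, rfl⟩
    refine ⟨⟨u, hu.1, rfl⟩, (key u).trans ?_⟩
    rw [(mem_frobInvariants.mp hu).2]
    rfl

/-- Transport of the conditions by conjugation and by central translation of `s̃`. -/
theorem IsFrobDatum.conj (hD : D.IsUnramified) {T : FTorus F} {s h : X} {φ : weilGroup F}
    (hT : D.IsFrobDatum T s h φ) (x : X) {z : X} (hz : z ∈ Subgroup.center X) :
    D.IsFrobDatum T (z * (x * s * (D.theta x)⁻¹)) (x * h * (D.galAct φ x)⁻¹) φ := by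
  obtain ⟨⟨ι, hinj, hrange, hcoeff, hact⟩, hI, ⟨z₁, hz₁, hcoc⟩, hell⟩ := hT
  refine ⟨⟨(MulAut.conj x).toMonoidHom.comp ι, (MulAut.conj x).injective.comp hinj, ?_,
    hD.coeffs_conj _ _ x hcoeff, fun t => ?_⟩, hI, ⟨z₁ * z⁻¹, mul_mem hz₁ (inv_mem hz),
    cocycle_conj hD hz hz₁ hcoc x⟩, ?_⟩
  · rw [connCentralizer_conj s x z hz, MonoidHom.range_comp, hrange]
  · simp only [MonoidHom.comp_apply, MulEquiv.toMonoidHom_eq_coe, MonoidHom.coe_coe,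
      MulAut.conj_apply, map_mul, map_inv]
    rw [← hact]
    group
  · rw [frobInvariants_conj s h x z hz, neutral_map_conj, hell]
    ext y
    have hcen : ∀ u ∈ neutral D.centerInvariants, x * u * x⁻¹ = u := fun u hu => by
      rw [Subgroup.mem_center_iff.mp (centerInvariants_le_center (neutral_le _ hu)) x,
        mul_inv_cancel_right]
    constructor
    · rintro ⟨u, hu, rfl⟩
      exact (congrArg (· ∈ neutral D.centerInvariants) (hcen u hu)).mpr hu
    · exact fun hy => ⟨y, hy, hcen y hy⟩

/-- A sufficient condition for two data to be isomorphic. -/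
theorem frobGroup_iso (hD : D.IsUnramified) {T₁ T₂ : D.Triple} {h₁ h₂ x y z : X}
    {φ₁ φ₂ : weilGroup F} (hφ₁ : IsFrobeniusElt F (φ₁ : GaloisGroup F))
    (hφ₂ : IsFrobeniusElt F (φ₂ : GaloisGroup F))
    (hT₁ : T₁.group = D.frobGroup T₁.s h₁ φ₁) (hT₂ : T₂.group = D.frobGroup T₂.s h₂ φ₂)
    (hz : z ∈ Subgroup.center X)
    (hs : x * T₁.s * (D.theta x)⁻¹ = z * T₂.s) (hy : y ∈ D.connCentralizer T₂.s)
    (hh : x * h₁ * (D.galAct φ₁ x)⁻¹ = y * h₂) : T₁.Iso T₂ := by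
  have hC : D.connCentralizer T₂.s =
      (D.connCentralizer T₁.s).map (MulAut.conj x).toMonoidHom := by
    rw [← connCentralizer_conj T₁.s x z⁻¹ (inv_mem hz), hs, inv_mul_cancel_left]
  refine ⟨x, ?_, z, hz, hs⟩
  set f : D.LGroup →* D.LGroup :=
    (MulAut.conj (SemidirectProduct.inl x : D.LGroup)).toMonoidHom with hf
  have hfl : ∀ u : X, f (SemidirectProduct.inl u) = SemidirectProduct.inl (x * u * x⁻¹) := by
    intro u
    simp [hf]
  have hfI : ∀ w : weilGroup F, (w : GaloisGroup F) ∈ inertiaGroup F →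
      f ⟨1, w⟩ = (⟨1, w⟩ : D.LGroup) := by
    intro w hw
    ext
    · simp [hf, hD.galAct_inertia w hw]
    · simp [hf]
  have hi : ((φ₂⁻¹ * φ₁ : weilGroup F) : GaloisGroup F) ∈ inertiaGroup F := hφ₂.inv_mul_mem hφ₁
  -- The lifts of two different Frobenius elements are compared through the inertial element `φ₂⁻¹
  -- φ₁`, so the choice of Frobenius element is immaterial.
  have hfF : f ⟨h₁, φ₁⟩ = SemidirectProduct.inl y * ⟨h₂, φ₂⟩ * ⟨1, φ₂⁻¹ * φ₁⟩ := by
    ext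
    · simp only [hf, MulEquiv.toMonoidHom_eq_coe, MonoidHom.coe_coe, MulAut.conj_apply,
        SemidirectProduct.mul_left, SemidirectProduct.left_inl, SemidirectProduct.right_inl,
        SemidirectProduct.mul_right, one_mul, ← map_inv, map_one, MulAut.one_apply, mul_one]
      rw [← hh, map_inv]
    · simp [hf]
  rw [hT₁, hT₂]
  apply le_antisymm
  · rw [Subgroup.map_le_iff_le_comap]
    refine frobGroup_le (fun u hu => ?_) (fun w hw => ?_) ?_
    · change f (SemidirectProduct.inl u) ∈ D.frobGroup T₂.s h₂ φ₂
      rw [hfl]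
      exact inl_mem_frobGroup (by rw [hC]; exact ⟨u, hu, rfl⟩)
    · rw [Subgroup.mem_comap, hfI w hw]
      exact inertia_mem_frobGroup hw
    · rw [Subgroup.mem_comap, hfF]
      exact mul_mem (mul_mem (inl_mem_frobGroup hy) frob_mem_frobGroup) (inertia_mem_frobGroup hi)
  · have hCmem : ∀ u ∈ D.connCentralizer T₂.s, (SemidirectProduct.inl u : D.LGroup) ∈
        (D.frobGroup T₁.s h₁ φ₁).map f := by
      intro u hu
      rw [hC] at hu
      obtain ⟨u', hu', rfl⟩ := hu
      exact ⟨_, inl_mem_frobGroup hu', hfl u'⟩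
    have hImem : ∀ w : weilGroup F, (w : GaloisGroup F) ∈ inertiaGroup F →
        (⟨1, w⟩ : D.LGroup) ∈ (D.frobGroup T₁.s h₁ φ₁).map f :=
      fun w hw => ⟨_, inertia_mem_frobGroup hw, hfI w hw⟩
    refine frobGroup_le hCmem hImem ?_
    have h3 : (⟨h₂, φ₂⟩ : D.LGroup) =
        (SemidirectProduct.inl y)⁻¹ * f ⟨h₁, φ₁⟩ * (⟨1, φ₂⁻¹ * φ₁⟩ : D.LGroup)⁻¹ := by
      rw [hfF]; group
    rw [h3]
    exact mul_mem (mul_mem (inv_mem (hCmem y hy)) ⟨_, frob_mem_frobGroup, rfl⟩)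
      (inv_mem (hImem _ hi))

end DualSide
end Data

/-! ### Pairs of matrices with `s h s⁻¹ = α h`. -/

section LinearAlgebra

open Matrix

variable {n : ℕ}

local notation "scalarGL" => Matrix.GeneralLinearGroup.scalar (Fin n) (R := ℂ)

theorem scalarGL_mem_center (c : ℂˣ) : scalarGL c ∈ Subgroup.center (GL (Fin n) ℂ) := by
  rw [Matrix.GeneralLinearGroup.center_eq_range_scalar]
  exact ⟨c, rfl⟩

theorem scalarGL_comm (c : ℂˣ) (x : GL (Fin n) ℂ) : x * scalarGL c = scalarGL c * x :=
  Subgroup.mem_center_iff.mp (scalarGL_mem_center c) x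

theorem coe_scalarGL_mul (c : ℂˣ) (x : GL (Fin n) ℂ) :
    ((scalarGL c * x : GL (Fin n) ℂ) : Matrix (Fin n) (Fin n) ℂ) = (c : ℂ) • (x : Matrix _ _ ℂ) := by
  rw [Units.val_mul]
  change Matrix.scalar (Fin n) (c : ℂ) * _ = _
  rw [Matrix.scalar_apply, ← Matrix.smul_one_eq_diagonal, smul_mul_assoc, one_mul]

theorem gl_mulVec_ne_zero (x : GL (Fin n) ℂ) {v : Fin n → ℂ} (hv : v ≠ 0) :
    (x : Matrix (Fin n) (Fin n) ℂ) *ᵥ v ≠ 0 := by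
  intro h
  apply hv
  have h2 : ((x⁻¹ : GL (Fin n) ℂ) : Matrix (Fin n) (Fin n) ℂ) *ᵥ
      ((x : Matrix (Fin n) (Fin n) ℂ) *ᵥ v) = 0 := by rw [h, mulVec_zero]
  rwa [mulVec_mulVec, ← Units.val_mul, inv_mul_cancel, Units.val_one, one_mulVec] at h2

variable {α : ℂˣ}

theorem injective_mul_pow (hα : orderOf α = n) {c : ℂ} (hc : c ≠ 0) :
    Function.Injective fun i : Fin n => c * (α : ℂ) ^ (i : ℕ) := by
  intro i j hij
  have h := mul_left_cancel₀ hc hij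
  have h2 : α ^ (i : ℕ) = α ^ (j : ℕ) := Units.ext (by simpa using h)
  exact Fin.ext (pow_injOn_Iio_orderOf (by simp [hα]) (by simp [hα]) h2)

/-- A matrix with eigenvalues `c α ^ i`, where `α` has order `n`, is diagonalizable. -/
theorem exists_eigenbasis (hα : orderOf α = n) {s : Matrix (Fin n) (Fin n) ℂ} {c : ℂ}
    (hc : c ≠ 0) {v : Fin n → Fin n → ℂ} (hv : ∀ i, v i ≠ 0)
    (hsv : ∀ i, s *ᵥ v i = (c * (α : ℂ) ^ (i : ℕ)) • v i) :
    ∃ P : GL (Fin n) ℂ, ∀ i, (P : Matrix (Fin n) (Fin n) ℂ).col i = v i := by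
  have hlin : LinearIndependent ℂ v := Module.End.eigenvectors_linearIndependent' (toLin' s)
    (fun i : Fin n => c * (α : ℂ) ^ (i : ℕ)) (injective_mul_pow hα hc) v
    fun i => ⟨Module.End.mem_eigenspace_iff.mpr (by rw [toLin'_apply, hsv]), hv i⟩
  have hunit : IsUnit (Matrix.of v)ᵀ := linearIndependent_cols_iff_isUnit.mp hlin
  exact ⟨hunit.unit, fun i => rfl⟩

theorem mulVec_twist {s h : GL (Fin n) ℂ} (hsh : s * h * s⁻¹ = h * scalarGL α)
    (v : Fin n → ℂ) :
    (s : Matrix (Fin n) (Fin n) ℂ) *ᵥ ((h : Matrix (Fin n) (Fin n) ℂ) *ᵥ v) =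
      (α : ℂ) • ((h : Matrix (Fin n) (Fin n) ℂ) *ᵥ ((s : Matrix (Fin n) (Fin n) ℂ) *ᵥ v)) := by
  have h1 : s * h = scalarGL α * (h * s) := by
    rw [mul_inv_eq_iff_eq_mul.mp hsh, scalarGL_comm, mul_assoc]
  have h2 := congrArg (fun x : GL (Fin n) ℂ => (x : Matrix (Fin n) (Fin n) ℂ)) h1
  rw [coe_scalarGL_mul] at h2
  simp only [Units.val_mul] at h2
  rw [mulVec_mulVec, h2, mulVec_mulVec, smul_mulVec]

/-- Normal form of two matrices with `s h s⁻¹ = α h`, where `α` has order `n`: there is a basis of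
eigenvectors of `s` which is permuted cyclically by `h`, up to a scalar. -/
theorem exists_cyclic_eigenbasis (hn : 1 ≤ n) (hα : orderOf α = n) {s h : GL (Fin n) ℂ}
    (hsh : s * h * s⁻¹ = h * scalarGL α) :
    ∃ (P : GL (Fin n) ℂ) (c g : ℂˣ),
      (∀ i, (s : Matrix (Fin n) (Fin n) ℂ) *ᵥ (P : Matrix (Fin n) (Fin n) ℂ).col i =
        ((c : ℂ) * (α : ℂ) ^ (i : ℕ)) • (P : Matrix (Fin n) (Fin n) ℂ).col i) ∧
      ∀ i : Fin n, (h : Matrix (Fin n) (Fin n) ℂ) *ᵥ (P : Matrix (Fin n) (Fin n) ℂ).col i =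
        (g : ℂ) • (P : Matrix (Fin n) (Fin n) ℂ).col
          ⟨((i : ℕ) + 1) % n, Nat.mod_lt _ hn⟩ := by
  have : Nonempty (Fin n) := ⟨⟨0, hn⟩⟩
  have hαn : (α : ℂ) ^ n = 1 := by
    have := pow_orderOf_eq_one α
    rw [hα] at this
    simpa using congrArg Units.val this
  obtain ⟨c, hcev⟩ := Module.End.exists_eigenvalue (toLin' (s : Matrix (Fin n) (Fin n) ℂ))
  obtain ⟨v, hv⟩ := hcev.exists_hasEigenvector
  have hv0 : v ≠ 0 := hv.2
  have hsv : (s : Matrix (Fin n) (Fin n) ℂ) *ᵥ v = c • v := by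
    simpa using Module.End.mem_eigenspace_iff.mp hv.1
  have hc : c ≠ 0 := by
    rintro rfl
    rw [zero_smul] at hsv
    exact gl_mulVec_ne_zero s hv0 hsv
  let w : ℕ → Fin n → ℂ := fun k => (((h : Matrix (Fin n) (Fin n) ℂ) *ᵥ ·)^[k]) v
  have hwS : ∀ k, w (k + 1) = (h : Matrix (Fin n) (Fin n) ℂ) *ᵥ w k := fun k =>
    Function.iterate_succ_apply' _ _ _
  have hw0 : ∀ k, w k ≠ 0 := by
    intro k
    induction k with
    | zero => exact hv0
    | succ k ih => rw [hwS]; exact gl_mulVec_ne_zero h ih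
  have hsw : ∀ k, (s : Matrix (Fin n) (Fin n) ℂ) *ᵥ w k = (c * (α : ℂ) ^ k) • w k := by
    intro k
    induction k with
    | zero => rw [pow_zero, mul_one]; exact hsv
    | succ k ih =>
      rw [hwS, mulVec_twist hsh, ih, mulVec_smul, smul_smul]
      congr 1
      ring
  -- As `α ^ n = 1`, the vector `h ^ n v` has the same `s`-eigenvalue `c` as `v`. The `n`
  -- eigenvalues `c α ^ i` are distinct, so this eigenspace is a line.
  obtain ⟨d, hd⟩ : ∃ d : ℂ, w n = d • v := by
    obtain ⟨P, hP⟩ := exists_eigenbasis hα hc (fun i => hw0 (i : ℕ)) (fun i => hsw (i : ℕ))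
    obtain ⟨u, hu⟩ : ∃ u, w n = (P : Matrix (Fin n) (Fin n) ℂ) *ᵥ u := by
      refine ⟨((P⁻¹ : GL (Fin n) ℂ) : Matrix (Fin n) (Fin n) ℂ) *ᵥ w n, ?_⟩
      rw [mulVec_mulVec, ← Units.val_mul, mul_inv_cancel, Units.val_one, one_mulVec]
    have hexp : ∀ u : Fin n → ℂ, (P : Matrix (Fin n) (Fin n) ℂ) *ᵥ u =
        ∑ i, u i • w (i : ℕ) := by
      intro u
      rw [mulVec_eq_sum]
      refine Finset.sum_congr rfl fun i _ => ?_
      rw [← hP i]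
      ext j
      simp [Matrix.col, mul_comm]
    have hDu : (P : Matrix (Fin n) (Fin n) ℂ) *ᵥ (fun i : Fin n => (α : ℂ) ^ (i : ℕ) * u i - u i) = 0 := by
      have h1 := hsw n
      rw [hαn, mul_one, hu, hexp, mulVec_sum] at h1
      have h2 : ∑ i : Fin n, (α : ℂ) ^ (i : ℕ) • u i • w (i : ℕ) = ∑ i : Fin n, u i • w (i : ℕ) := by
        refine smul_right_injective _ hc ?_
        change c • _ = c • _
        rw [← h1, Finset.smul_sum]
        refine Finset.sum_congr rfl fun i _ => ?_
        rw [mulVec_smul, hsw, smul_smul, smul_smul, smul_smul]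
        congr 1
        ring
      rw [hexp]
      simp_rw [sub_smul, ← smul_smul]
      rw [Finset.sum_sub_distrib, h2, sub_self]
    have hzero : (fun i : Fin n => (α : ℂ) ^ (i : ℕ) * u i - u i) = (0 : Fin n → ℂ) := by
      by_contra hne
      exact gl_mulVec_ne_zero P hne hDu
    refine ⟨u ⟨0, hn⟩, ?_⟩
    rw [hu, hexp, Finset.sum_eq_single ⟨0, hn⟩]
    · rfl
    · intro i _ hi
      have h1 := congrFun hzero i
      simp only [Pi.zero_apply] at h1
      have h2 : ((α : ℂ) ^ (i : ℕ) - 1) * u i = 0 := by linear_combination h1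
      rcases mul_eq_zero.mp h2 with h3 | h3
      · exfalso
        apply hi
        apply injective_mul_pow hα one_ne_zero
        simpa using sub_eq_zero.mp h3
      · rw [h3, zero_smul]
    · simp
  have hd0 : d ≠ 0 := by
    rintro rfl
    exact hw0 n (by rw [hd, zero_smul])
  -- Rescaling the `k`-th vector by `g⁻¹ ^ k`, with `g ^ n = d`, makes the sequence `n`-periodic,
  -- and `h` then sends each vector to `g` times the next.
  obtain ⟨g, hg⟩ := IsAlgClosed.exists_pow_nat_eq d hn
  have hg0 : g ≠ 0 := by
    rintro rfl
    exact hd0 (by rw [← hg, zero_pow (by omega)])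
  let y : ℕ → Fin n → ℂ := fun k => (g⁻¹ ^ k) • w k
  have hyS : ∀ k, (h : Matrix (Fin n) (Fin n) ℂ) *ᵥ y k = g • y (k + 1) := by
    intro k
    change _ *ᵥ (g⁻¹ ^ k • w k) = g • (g⁻¹ ^ (k + 1) • w (k + 1))
    rw [mulVec_smul, hwS, smul_smul]
    congr 1
    rw [pow_succ']
    field_simp
  have hper : Function.Periodic y n := by
    intro k
    induction k with
    | zero =>
      change g⁻¹ ^ (0 + n) • w (0 + n) = g⁻¹ ^ 0 • w 0
      rw [zero_add, hd, smul_smul, ← hg, inv_pow, inv_mul_cancel₀ (pow_ne_zero _ hg0), pow_zero]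
      rfl
    | succ k ih =>
      have h1 := hyS (k + n)
      rw [ih, hyS] at h1
      rw [add_right_comm]
      exact (smul_right_injective _ hg0 h1).symm
  obtain ⟨P, hP⟩ := exists_eigenbasis hα hc (v := fun i : Fin n => y i)
    (s := (s : Matrix (Fin n) (Fin n) ℂ))
    (fun i => smul_ne_zero (pow_ne_zero _ (inv_ne_zero hg0)) (hw0 _)) (fun i => by
      change _ *ᵥ (_ • w i) = _ • (_ • w i)
      rw [mulVec_smul, hsw, smul_comm])
  refine ⟨P, Units.mk0 c hc, Units.mk0 g hg0, fun i => ?_, fun i => ?_⟩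
  · rw [hP]
    change _ *ᵥ (_ • w i) = _ • (_ • w i)
    rw [mulVec_smul, hsw, smul_comm]
    rfl
  · rw [hP, hP, hyS]
    change _ = g • y (((i : ℕ) + 1) % n)
    rw [hper.map_mod_nat]

theorem col_mul_eq (A P : Matrix (Fin n) (Fin n) ℂ) (i : Fin n) : (A * P).col i = A *ᵥ P.col i :=
  rfl

theorem matrix_ext_col {A B : Matrix (Fin n) (Fin n) ℂ} (h : ∀ i, A.col i = B.col i) : A = B :=
  Matrix.ext fun i j => congrFun (h j) i

/-- Two pairs of matrices with `s h s⁻¹ = α h`, where `α` has order `n`, are conjugate up to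
scalars. -/
theorem exists_conj_of_twist (hn : 1 ≤ n) (hα : orderOf α = n) {s₁ h₁ s₂ h₂ : GL (Fin n) ℂ}
    (hsh₁ : s₁ * h₁ * s₁⁻¹ = h₁ * scalarGL α) (hsh₂ : s₂ * h₂ * s₂⁻¹ = h₂ * scalarGL α) :
    ∃ (x : GL (Fin n) ℂ) (c g : ℂˣ),
      x * s₁ * x⁻¹ = scalarGL c * s₂ ∧ x * h₁ * x⁻¹ = scalarGL g * h₂ := by
  obtain ⟨P₁, c₁, g₁, hs₁, hh₁⟩ := exists_cyclic_eigenbasis hn hα hsh₁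
  obtain ⟨P₂, c₂, g₂, hs₂, hh₂⟩ := exists_cyclic_eigenbasis hn hα hsh₂
  -- The change of basis from `P₁` to `P₂` intertwines, up to a scalar, two matrices with the same
  -- monomial shape. This is applied to `s` with weights `α ^ i` and no permutation, then to `h`
  -- with the cyclic permutation.
  have key : ∀ (y₁ y₂ : GL (Fin n) ℂ) (c₁ c₂ : ℂˣ) (d : Fin n → ℂ) (f : Fin n → Fin n),
      (∀ i, (y₁ : Matrix (Fin n) (Fin n) ℂ) *ᵥ (P₁ : Matrix (Fin n) (Fin n) ℂ).col i =
        ((c₁ : ℂ) * d i) • (P₁ : Matrix (Fin n) (Fin n) ℂ).col (f i)) →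
      (∀ i, (y₂ : Matrix (Fin n) (Fin n) ℂ) *ᵥ (P₂ : Matrix (Fin n) (Fin n) ℂ).col i =
        ((c₂ : ℂ) * d i) • (P₂ : Matrix (Fin n) (Fin n) ℂ).col (f i)) →
      P₂ * P₁⁻¹ * y₁ * (P₂ * P₁⁻¹)⁻¹ = scalarGL (c₁ * c₂⁻¹) * y₂ := by
    intro y₁ y₂ c₁ c₂ d f H₁ H₂
    have hcol : ∀ i, ((P₂ * P₁⁻¹ : GL (Fin n) ℂ) : Matrix (Fin n) (Fin n) ℂ) *ᵥ
        (P₁ : Matrix (Fin n) (Fin n) ℂ).col i = (P₂ : Matrix (Fin n) (Fin n) ℂ).col i := by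
      intro i
      rw [← col_mul_eq, ← Units.val_mul, inv_mul_cancel_right]
    rw [mul_inv_eq_iff_eq_mul]
    refine mul_right_cancel (b := P₁) ?_
    rw [mul_assoc (scalarGL _ * y₂), inv_mul_cancel_right, mul_assoc, mul_assoc (scalarGL _)]
    refine Units.ext ?_
    rw [coe_scalarGL_mul]
    refine matrix_ext_col fun i => ?_
    rw [Units.val_mul, col_mul_eq, Units.val_mul y₁, col_mul_eq, H₁, mulVec_smul, hcol,
      Units.val_mul y₂]
    have h3 : ((((c₁ * c₂⁻¹ : ℂˣ) : ℂ) •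
        ((y₂ : Matrix (Fin n) (Fin n) ℂ) * (P₂ : Matrix (Fin n) (Fin n) ℂ))).col i) =
        ((c₁ * c₂⁻¹ : ℂˣ) : ℂ) • ((y₂ : Matrix (Fin n) (Fin n) ℂ) *
          (P₂ : Matrix (Fin n) (Fin n) ℂ)).col i := rfl
    rw [h3, col_mul_eq, H₂, smul_smul]
    congr 1
    have hc₂ : (c₂ : ℂ) ≠ 0 := c₂.ne_zero
    push_cast
    field_simp
  refine ⟨P₂ * P₁⁻¹, c₁ * c₂⁻¹, g₁ * g₂⁻¹, key _ _ _ _ (fun i => (α : ℂ) ^ (i : ℕ)) id hs₁ hs₂,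
    key _ _ _ _ (fun _ => 1) (fun i => ⟨((i : ℕ) + 1) % n, Nat.mod_lt _ hn⟩) ?_ ?_⟩
  · simpa using hh₁
  · simpa using hh₂

theorem exists_conj_mem_diagTorus (hn : 1 ≤ n) (hα : orderOf α = n) {s h : GL (Fin n) ℂ}
    (hsh : s * h * s⁻¹ = h * scalarGL α) : ∃ x : GL (Fin n) ℂ, x * s * x⁻¹ ∈ diagTorus n := by
  obtain ⟨P, c, g, hs, -⟩ := exists_cyclic_eigenbasis hn hα hsh
  refine ⟨P⁻¹, MulEquiv.piUnits.symm (fun i : Fin n => c * α ^ (i : ℕ)), ?_⟩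
  rw [inv_inv, mul_assoc]
  refine eq_inv_mul_of_mul_eq (Units.ext (matrix_ext_col fun i => ?_))
  rw [Units.val_mul s, col_mul_eq, hs]
  funext j
  rw [Units.val_mul]
  change ((P : Matrix (Fin n) (Fin n) ℂ) *
    Matrix.diagonal (fun i : Fin n => ((c * α ^ (i : ℕ) : ℂˣ) : ℂ)) : Matrix _ _ ℂ) j i = _
  rw [Matrix.mul_diagonal, mul_comm]
  push_cast
  rfl

/-- The exponential joins every scalar matrix to `1` by a path of scalar matrices. -/
theorem scalarGL_mem_neutral {S : Subgroup (GL (Fin n) ℂ)} (hS : ∀ c, scalarGL c ∈ S) (c : ℂˣ) :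
    scalarGL c ∈ neutral S := by
  let f : ℂ → GL (Fin n) ℂ := fun z => scalarGL (Units.mk0 (Complex.exp z) (Complex.exp_ne_zero z))
  have hf : Continuous f := by
    refine Units.continuous_iff.mpr ⟨?_, ?_⟩
    · change Continuous fun z => Matrix.scalar (Fin n) (Complex.exp z)
      simp only [Matrix.scalar_apply]
      fun_prop
    · change Continuous fun z => Matrix.scalar (Fin n) (Complex.exp z)⁻¹
      simp only [Matrix.scalar_apply, ← Complex.exp_neg]
      fun_prop
  have h0 : f 0 = 1 := by
    change scalarGL _ = 1
    rw [show Units.mk0 (Complex.exp 0) (Complex.exp_ne_zero 0) = 1 from Units.ext (by simp),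
      map_one]
  have h1 := mem_neutral_of_continuous hf h0 (fun z => hS _) (Complex.log c)
  have h2 : Units.mk0 (Complex.exp (Complex.log c)) (Complex.exp_ne_zero _) = c :=
    Units.ext (Complex.exp_log c.ne_zero)
  rwa [← h2]

/-- Regular functions are stable under conjugation of a family of matrices. -/
theorem conj_entry_mem_laurent {r : ℕ} {f : (Fin r → ℂˣ) → GL (Fin n) ℂ}
    (hf : ∀ i j, (fun t => (f t : Matrix (Fin n) (Fin n) ℂ) i j) ∈ laurent r)
    (x : GL (Fin n) ℂ) (i j : Fin n) :
    (fun t => ((x * f t * x⁻¹ : GL (Fin n) ℂ) : Matrix (Fin n) (Fin n) ℂ) i j) ∈ laurent r := by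
  have h : (fun t => ((x * f t * x⁻¹ : GL (Fin n) ℂ) : Matrix (Fin n) (Fin n) ℂ) i j) =
      ∑ l, ∑ k, ((x : Matrix (Fin n) (Fin n) ℂ) i k *
        ((x⁻¹ : GL (Fin n) ℂ) : Matrix (Fin n) (Fin n) ℂ) l j) •
          (fun t => (f t : Matrix (Fin n) (Fin n) ℂ) k l) := by
    funext t
    rw [Units.val_mul, Units.val_mul, Matrix.mul_apply, Finset.sum_apply]
    refine Finset.sum_congr rfl fun l _ => ?_
    rw [Matrix.mul_apply, Finset.sum_mul, Finset.sum_apply]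
    refine Finset.sum_congr rfl fun k _ => ?_
    rw [Pi.smul_apply, smul_eq_mul]
    ring
  rw [h]
  exact sum_mem fun l _ => sum_mem fun k _ => Subalgebra.smul_mem _ (hf k l) _

end LinearAlgebra

/-! ### Endoscopic data for `H`. -/

section H

variable {F : Type*} [Field F] [ValuativeRel F] [TopologicalSpace F]
  [IsNonarchimedeanLocalField F] {n : ℕ} {α : ℂˣ}

theorem dualH_isUnramified : (dualH F n α).IsUnramified where
  galAct_inertia _ _ := rfl
  theta_galAct _ _ := rfl
  aFrob_mem := scalarGL_mem_center α
  coeffs_conj := by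
    rintro r f x hf _ ⟨⟨i, j⟩, rfl⟩
    exact conj_entry_mem_laurent (fun i j => hf _ ⟨(i, j), rfl⟩) x i j

/-- Since `W_F` acts trivially, the coboundary of a central element is trivial and the value at
Frobenius is exactly `α`. -/
theorem dualH_cocycle_iff {s h z : GL (Fin n) ℂ} (hz : z ∈ Subgroup.center _) {φ : weilGroup F} :
    s * (dualH F n α).theta h * ((dualH F n α).galAct φ s)⁻¹ =
        h * (z⁻¹ * (dualH F n α).aFrob * (dualH F n α).galAct φ z) ↔
      s * h * s⁻¹ = h * Matrix.GeneralLinearGroup.scalar (Fin n) α := by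
  change s * h * s⁻¹ = h * (z⁻¹ * Matrix.GeneralLinearGroup.scalar (Fin n) α * z) ↔ _
  rw [mul_assoc z⁻¹, Subgroup.mem_center_iff.mp hz, inv_mul_cancel_left]

theorem dualH_twistedCentralizer (s : GL (Fin n) ℂ) :
    (dualH F n α).twistedCentralizer s = Subgroup.centralizer {s} := by
  ext y
  rw [DualSide.mem_twistedCentralizer, Subgroup.mem_centralizer_singleton_iff]
  exact mul_inv_eq_iff_eq_mul.trans eq_comm

theorem scalarGL_mem_connCentralizer (s : GL (Fin n) ℂ) (c : ℂˣ) :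
    Matrix.GeneralLinearGroup.scalar (Fin n) c ∈ (dualH F n α).connCentralizer s := by
  rw [DualSide.connCentralizer_eq]
  refine scalarGL_mem_neutral (fun c => ?_) c
  rw [dualH_twistedCentralizer, Subgroup.mem_centralizer_singleton_iff, scalarGL_comm]

theorem dualH_centerInvariants :
    (dualH F n α).centerInvariants = Subgroup.center (GL (Fin n) ℂ) := by
  refine le_antisymm DualSide.centerInvariants_le_center fun z hz => ?_
  refine Subgroup.mem_inf.mpr ⟨Subgroup.mem_inf.mpr ⟨hz, rfl⟩, ?_⟩
  exact Subgroup.mem_iInf.mpr fun w => rfl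

theorem DualSide.Triple.IsDatum.twist {T : (dualH F n α).Triple} (hT : T.IsDatum)
    {h : GL (Fin n) ℂ} {φ : weilGroup F} (hφ : IsFrobeniusElt F (φ : GaloisGroup F))
    (hh : (⟨h, φ⟩ : (dualH F n α).LGroup) ∈ T.group) :
    T.s * h * T.s⁻¹ = h * Matrix.GeneralLinearGroup.scalar (Fin n) α := by
  obtain ⟨z, hz, hzc⟩ := (hT.isFrobDatum dualH_isUnramified hφ hh).cocycle
  exact (dualH_cocycle_iff hz).mp hzc

/-- All endoscopic data for `(H, ω)` are isomorphic. -/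
theorem dualH_iso (hn : 1 ≤ n) (hα : orderOf α = n) {φ : weilGroup F}
    (hφ : IsFrobeniusElt F (φ : GaloisGroup F)) {T₁ T₂ : (dualH F n α).Triple}
    (hT₁ : T₁.IsDatum) (hT₂ : T₂.IsDatum) : T₁.Iso T₂ := by
  obtain ⟨h₁, hh₁⟩ := hT₁.surj φ
  obtain ⟨h₂, hh₂⟩ := hT₂.surj φ
  obtain ⟨x, c, g, hs, hh⟩ := exists_conj_of_twist hn hα (hT₁.twist hφ hh₁) (hT₂.twist hφ hh₂)
  exact DualSide.frobGroup_iso dualH_isUnramified hφ hφ (hT₁.group_eq hφ hh₁)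
    (hT₂.group_eq hφ hh₂) (scalarGL_mem_center c) hs (scalarGL_mem_connCentralizer _ g) hh

/-- Every endoscopic datum for `(H, ω)` is isomorphic to one with `s` diagonal. -/
theorem dualH_exists_diag [CharZero F] {φ : weilGroup F}
    (hφ : IsFrobeniusElt F (φ : GaloisGroup F)) (T : (dualH F n α).Datum) :
    ∃ (T' : (dualH F n α).Datum) (h : GL (Fin n) ℂ),
      T'.cls = T.cls ∧ T'.1.s ∈ diagTorus n ∧
        (⟨h, φ⟩ : (dualH F n α).LGroup) ∈ T'.1.group := by
  obtain ⟨h, hh⟩ := T.2.surj φ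
  obtain ⟨x, hx⟩ := T.2.semisimple
  have hD : (dualH F n α).IsUnramified := dualH_isUnramified
  have hK := (T.2.isFrobDatum hD hφ hh).conj hD x (one_mem _)
  rw [one_mul] at hK
  have hdat := hK.isDatum hD hφ ⟨1, by simpa using hx⟩
  refine ⟨⟨_, hdat⟩, _, ?_, hx, DualSide.frob_mem_frobGroup⟩
  refine Quotient.sound (DualSide.Triple.Iso.symm ?_)
  exact DualSide.frobGroup_iso hD hφ hφ (T.2.group_eq hφ hh) rfl (one_mem _)
    (one_mul _).symm (one_mem _) (one_mul _).symm

end H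

/-! ### Powers of the cyclic rotation. -/

section Rotation

variable {m : ℕ}

theorem coe_finRotate_eq_ite (i : Fin m) :
    (finRotate m i : ℕ) = if (i : ℕ) + 1 = m then 0 else (i : ℕ) + 1 := by
  have := i.neZero
  rw [finRotate_apply, Fin.val_add, Fin.val_one', Nat.add_mod_mod]
  split_ifs with h
  · rw [h, Nat.mod_self]
  · exact Nat.mod_eq_of_lt (by omega)

theorem coe_finRotate_pow (k : ℕ) (i : Fin m) : ((finRotate m ^ k) i : ℕ) = (i + k) % m := by
  induction k with
  | zero => exact (Nat.mod_eq_of_lt i.2).symm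
  | succ k ih =>
    have := i.neZero
    rw [pow_succ', Equiv.Perm.mul_apply, finRotate_apply, Fin.val_add, Fin.val_one',
      Nat.add_mod_mod, ih, Nat.mod_add_mod, add_assoc]

/-- Frobenius acts by `θ̂ ^ (-a)`. Writing the rotated index through `a % m` turns the later
entrywise comparisons into linear inequalities. -/
theorem coe_finRotate_zpow_neg (a : ℤ) (i : Fin m) :
    (((finRotate m ^ (-a)) i : ℕ) : ℤ) =
      if a % m ≤ (i : ℕ) then (i : ℕ) - a % m else (i : ℕ) - a % m + m := by
  have hm : (0 : ℤ) < m := by have := i.2; omega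
  have hr0 := Int.emod_nonneg a hm.ne'
  have hr1 := Int.emod_lt_of_pos a hm
  obtain ⟨r, hr⟩ := Int.eq_ofNat_of_zero_le hr0
  set j := (finRotate m ^ (-a)) i with hj
  have hrot : finRotate m ^ a = finRotate m ^ r := by
    rw [← Int.emod_add_mul_ediv a m, zpow_add, zpow_mul, zpow_natCast, finRotate_pow_self,
      one_zpow, mul_one, hr, zpow_natCast]
  have hi : (finRotate m ^ r) j = i := by
    rw [hj, ← hrot, ← Equiv.Perm.mul_apply, ← zpow_add, add_neg_cancel, zpow_zero,
      Equiv.Perm.one_apply]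
  have h1 := coe_finRotate_pow r j
  rw [hi] at h1
  rw [hr] at hr1 ⊢
  have hj2 := j.2
  by_cases hlt : (j : ℕ) + r < m
  · rw [Nat.mod_eq_of_lt hlt] at h1
    rw [if_pos (by omega)]
    omega
  · rw [Nat.mod_eq_sub_mod (by omega), Nat.mod_eq_of_lt (by omega)] at h1
    rw [if_neg (by omega)]
    omega

theorem shift_zpow_apply (n m : ℕ) (k : ℤ) (x : Fin m → GL (Fin n) ℂ) (i : Fin m) :
    (shift n m ^ k) x i = x ((finRotate m ^ k) i) := by
  obtain ⟨k, rfl | rfl⟩ := k.eq_nat_or_neg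
  · rw [zpow_natCast, zpow_natCast, shift_pow_apply]
  · rw [zpow_neg, zpow_neg, zpow_natCast, zpow_natCast]
    have h : (shift n m ^ k) (fun i => x ((finRotate m ^ k)⁻¹ i)) = x := by
      funext i
      rw [shift_pow_apply]
      exact congrArg x ((finRotate m ^ k).symm_apply_apply i)
    conv_lhs => rw [← h]
    rw [MulAut.inv_apply_self]

theorem shift_apply (n m : ℕ) (x : Fin m → GL (Fin n) ℂ) (i : Fin m) :
    shift n m x i = x (finRotate m i) := rfl

end Rotation

/-! ### The twisted cocycle equation in `GL(n, ℂ)^m`. -/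

section Vector

variable {n m : ℕ} {α : ℂˣ}

/-- With `x_i` the product of the entries of `s` before position `i`, everything telescopes: each
entry becomes `1` except the last, which collects the full product. -/
theorem lastEntry_coboundary (s : Fin m → GL (Fin n) ℂ) :
    ∃ (x : Fin m → GL (Fin n) ℂ) (t : GL (Fin n) ℂ),
      x * s * (shift n m x)⁻¹ = lastEntry m t := by
  let y : ℕ → GL (Fin n) ℂ := fun k =>
    Nat.rec 1 (fun k z => z * if h : k < m then s ⟨k, h⟩ else 1) k
  have hy : ∀ i : Fin m, y ((i : ℕ) + 1) = y i * s i := fun i => by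
    change y i * (if h : (i : ℕ) < m then s ⟨i, h⟩ else 1) = _
    rw [dif_pos i.2]
  refine ⟨fun i => y i, y m, funext fun i => ?_⟩
  change y i * s i * (y (finRotate m i))⁻¹ = _
  rw [← hy, coe_finRotate_eq_ite, lastEntry]
  split_ifs with h
  · rw [h]
    change y m * 1⁻¹ = _
    rw [inv_one, mul_one]
  · rw [mul_inv_cancel]

/-- In the zero-based index `i`, the factor `s` on the left occurs only at `i = m - 1`, and `s⁻¹` on
the right only where `i + 1 ≡ a` modulo `m`. The latter accounts for the jump from `h` to `h s`, the
former for the wrap-around, where `s h = h s α` produces `α`. -/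
theorem hVector_cocycle (a : ℤ) {s h : GL (Fin n) ℂ}
    (hsh : s * h * s⁻¹ = h * Matrix.GeneralLinearGroup.scalar (Fin n) α) :
    lastEntry m s * shift n m (hVector m a h s) * ((shift n m ^ (-a)) (lastEntry m s))⁻¹ =
      hVector m a h s * lastEntry m (Matrix.GeneralLinearGroup.scalar (Fin n) α) := by
  have hsh' : s * h = h * s * Matrix.GeneralLinearGroup.scalar (Fin n) α := by
    rw [mul_inv_eq_iff_eq_mul.mp hsh, mul_assoc, ← scalarGL_comm, mul_assoc]
  funext i
  have hm : (0 : ℤ) < m := by have := i.2; omega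
  have hr0 := Int.emod_nonneg a hm.ne'
  have hr1 := Int.emod_lt_of_pos a hm
  have h1 := coe_finRotate_eq_ite i
  have h2 := coe_finRotate_zpow_neg a i
  have hi := i.2
  simp only [Pi.mul_apply, Pi.inv_apply, shift_zpow_apply, shift_apply, lastEntry, hVector]
  generalize (finRotate m ^ (-a)) i = k at h2 ⊢
  generalize finRotate m i = l at h1 ⊢
  generalize a % (m : ℤ) = r at *
  split_ifs at h1 h2 <;> split_ifs <;> first
    | omega
    | (simp only [one_mul, mul_one, inv_one, hsh']; done)
    | (rw [← mul_assoc s, hsh', mul_assoc _ _ s⁻¹]; simp [mul_assoc, scalarGL_comm])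
    | simp [mul_assoc]

/-- The equation at index `k < m - 1` determines `v (k + 1)` from `v k`, so `v 0` determines `v`.
The last equation, which closes the cycle, is the relation `s h s⁻¹ = α h`. -/
theorem exists_eq_hVector [NeZero m] (a : ℤ) {s : GL (Fin n) ℂ} {v : Fin m → GL (Fin n) ℂ}
    (hv : lastEntry m s * shift n m v * ((shift n m ^ (-a)) (lastEntry m s))⁻¹ =
      v * lastEntry m (Matrix.GeneralLinearGroup.scalar (Fin n) α)) :
    ∃ h : GL (Fin n) ℂ, v = hVector m a h s ∧
      s * h * s⁻¹ = h * Matrix.GeneralLinearGroup.scalar (Fin n) α := by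
  have hm : (0 : ℤ) < m := by exact_mod_cast NeZero.pos m
  have hr0 := Int.emod_nonneg a hm.ne'
  have hr1 := Int.emod_lt_of_pos a hm
  -- When `m` divides `a` there is no entry `h`, and the first entry is already `h s`.
  let h := if a % m = 0 then v 0 * s⁻¹ else v 0
  have hmain : ∀ k (hk : k < m), v ⟨k, hk⟩ = hVector m a h s ⟨k, hk⟩ := by
    intro k
    induction k with
    | zero =>
      intro hk
      change v 0 = _
      simp only [hVector, h]
      split_ifs <;> first | omega | simp
    | succ k ih =>
      intro hk
      have hk' : k < m := by omega
      have h0 := congrFun hv ⟨k, hk'⟩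
      have h1 : finRotate m ⟨k, hk'⟩ = ⟨k + 1, hk⟩ := by
        apply Fin.ext
        rw [coe_finRotate_eq_ite, if_neg (by dsimp only; omega)]
      have h2 := coe_finRotate_zpow_neg a ⟨k, hk'⟩
      simp only [Pi.mul_apply, Pi.inv_apply, shift_zpow_apply, shift_apply, h1, ih hk'] at h0
      generalize (finRotate m ^ (-a)) ⟨k, hk'⟩ = j at h2 h0
      simp only [lastEntry, hVector] at h0 h2 ⊢
      clear_value h
      generalize a % (m : ℤ) = r at *
      split_ifs at h0 h2 ⊢ <;> first
        | omega
        | (simp only [one_mul, mul_one, inv_one, mul_inv_eq_iff_eq_mul] at h0; exact h0)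
  have hvec : v = hVector m a h s := funext fun i => hmain i i.2
  refine ⟨h, hvec, ?_⟩
  have hlt : m - 1 < m := by omega
  have h0 := congrFun hv ⟨m - 1, hlt⟩
  have h1 := coe_finRotate_eq_ite (⟨m - 1, hlt⟩ : Fin m)
  have h2 := coe_finRotate_zpow_neg a ⟨m - 1, hlt⟩
  rw [hvec] at h0
  simp only [Pi.mul_apply, Pi.inv_apply, shift_zpow_apply, shift_apply] at h0
  generalize (finRotate m ^ (-a)) ⟨m - 1, hlt⟩ = j at h2 h0
  generalize finRotate m ⟨m - 1, hlt⟩ = l at h1 h0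
  simp only [lastEntry, hVector] at h0 h1 h2
  clear_value h
  clear hvec hmain hv
  generalize a % (m : ℤ) = r at *
  rw [mul_inv_eq_iff_eq_mul]
  split_ifs at h0 h1 h2 <;> first
    | omega
    | (rw [inv_one, mul_one] at h0; rw [h0, mul_assoc, mul_assoc, scalarGL_comm])
    | (rw [← mul_assoc s, mul_inv_cancel_right, mul_assoc h, scalarGL_comm, ← mul_assoc] at h0
       exact h0)

end Vector

/-! ### Endoscopic data for `(G̃, ω_E)` and comparison with `H`. -/

section G

variable {F : Type*} [Field F] [ValuativeRel F] [TopologicalSpace F]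
  [IsNonarchimedeanLocalField F]
  {E : IntermediateField F (AlgebraicClosure F)} [FiniteDimensional F E] [IsGalois F E]
  {m : ℕ} (hm : Module.finrank F E = m)
  {θ : E ≃ₐ[F] E} (hθ : ∀ τ : E ≃ₐ[F] E, τ ∈ Subgroup.zpowers θ) {n : ℕ} {α : ℂˣ}

theorem restrictNormalHom_eq_one (hE : E ≤ maxUnramified F) {σ : GaloisGroup F}
    (hσ : σ ∈ inertiaGroup F) : AlgEquiv.restrictNormalHom E σ = 1 := by
  ext x
  have h1 : ((AlgEquiv.restrictNormalHom E σ x : E) : AlgebraicClosure F) = σ x :=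
    AlgEquiv.restrictNormal_commutes σ E x
  rw [h1, AlgEquiv.one_apply]
  exact (IntermediateField.mem_fixedField_iff _ _).mp (hE x.2) σ hσ

theorem dualG_galAct_mem_zpowers (w : weilGroup F) :
    ∃ k : ℤ, (dualG hm hθ n α).galAct w = shift n m ^ k := by
  obtain ⟨k, hk⟩ := hθ (AlgEquiv.restrictNormalHom E (w : GaloisGroup F))
  refine ⟨k, ?_⟩
  change monoidHomOfForallMemZpowers hθ (orderOf_shift_dvd hm hθ n)
    (AlgEquiv.restrictNormalHom E (w : GaloisGroup F)) = _
  rw [← hk, map_zpow, monoidHomOfForallMemZpowers_apply_gen]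

/-- All Frobenius elements have the same restriction `f` to the unramified extension `E`. As `f ^ m
= 1` and `f ^ e = θ`, the relation `b m - a e = 1` gives `f = θ ^ (-a)`. -/
theorem dualG_galAct_frob (hE : E ≤ maxUnramified F) {φ ψ : weilGroup F}
    (hφ : IsFrobeniusElt F (φ : GaloisGroup F)) (hψ : IsFrobeniusElt F (ψ : GaloisGroup F))
    {e a b : ℤ} (he : AlgEquiv.restrictNormalHom E (φ : GaloisGroup F) ^ e = θ)
    (hab : b * m - a * e = 1) : (dualG hm hθ n α).galAct ψ = shift n m ^ (-a) := by
  change monoidHomOfForallMemZpowers hθ (orderOf_shift_dvd hm hθ n)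
    (AlgEquiv.restrictNormalHom E (ψ : GaloisGroup F)) = _
  have h1 : AlgEquiv.restrictNormalHom E (ψ : GaloisGroup F) =
      AlgEquiv.restrictNormalHom E (φ : GaloisGroup F) := by
    have := restrictNormalHom_eq_one hE (hφ.inv_mul_mem hψ)
    rw [map_mul, map_inv, inv_mul_eq_one] at this
    exact this.symm
  have h2 : AlgEquiv.restrictNormalHom E (φ : GaloisGroup F) = θ ^ (-a) := by
    set f := AlgEquiv.restrictNormalHom E (φ : GaloisGroup F) with hf
    have hfm : f ^ m = 1 := by
      rw [← hm, ← IsGalois.card_aut_eq_finrank F E]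
      exact pow_card_eq_one'
    calc f = f ^ (b * m - a * e) := by rw [hab, zpow_one]
      _ = (f ^ m) ^ b * (f ^ e) ^ (-a) := by
          rw [← zpow_natCast, ← zpow_mul, ← zpow_mul, ← zpow_add]
          congr 1
          ring
      _ = θ ^ (-a) := by rw [hfm, one_zpow, one_mul, he]
  rw [h1, h2, map_zpow, monoidHomOfForallMemZpowers_apply_gen]

theorem mem_center_pi {z : Fin m → GL (Fin n) ℂ} :
    z ∈ Subgroup.center (Fin m → GL (Fin n) ℂ) ↔
      ∀ i, z i ∈ Subgroup.center (GL (Fin n) ℂ) := by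
  rw [Subgroup.center_pi, Subgroup.mem_pi]
  simp

theorem dualG_isUnramified (hE : E ≤ maxUnramified F) : (dualG hm hθ n α).IsUnramified where
  galAct_inertia w hw := by
    change monoidHomOfForallMemZpowers hθ (orderOf_shift_dvd hm hθ n)
      (AlgEquiv.restrictNormalHom E (w : GaloisGroup F)) = _
    rw [restrictNormalHom_eq_one hE hw, map_one]
  theta_galAct w x := by
    obtain ⟨k, hk⟩ := dualG_galAct_mem_zpowers (α := α) (n := n) hm hθ w
    rw [hk]
    change (shift n m * shift n m ^ k) x = (shift n m ^ k * shift n m) x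
    rw [(Commute.self_zpow (shift n m) k).eq]
  aFrob_mem := by
    refine mem_center_pi.mpr fun i => ?_
    change (if _ then _ else _) ∈ _
    split_ifs
    exacts [scalarGL_mem_center α, one_mem _]
  coeffs_conj := by
    rintro r f x hf _ ⟨⟨k, i, j⟩, rfl⟩
    exact conj_entry_mem_laurent (f := fun t => f t k) (fun i j => hf _ ⟨(k, i, j), rfl⟩) (x k) i j

/-- The diagonal embedding of `GL(n, ℂ)` in `GL(n, ℂ)^m`. -/
abbrev diagEmb (n m : ℕ) : GL (Fin n) ℂ →* (Fin m → GL (Fin n) ℂ) :=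
  Pi.constMonoidHom (Fin m) (GL (Fin n) ℂ)

theorem shift_zpow_diagEmb (k : ℤ) (x : GL (Fin n) ℂ) :
    (shift n m ^ k) (diagEmb n m x) = diagEmb n m x := by
  funext i
  rw [shift_zpow_apply]
  rfl

theorem neutral_map_diagEmb [NeZero m] (S : Subgroup (GL (Fin n) ℂ)) :
    neutral (S.map (diagEmb n m)) = (neutral S).map (diagEmb n m) :=
  neutral_map (g := Pi.evalMonoidHom _ 0) (continuous_pi fun _ => continuous_id)
    (continuous_apply 0) (fun _ => rfl) S

theorem diagEmb_injective [NeZero m] : Function.Injective (diagEmb n m) := fun _ _ h =>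
  congrFun h 0

theorem eq_diagEmb [NeZero m] {y : Fin m → GL (Fin n) ℂ}
    (hy : ∀ i : Fin m, (i : ℕ) + 1 ≠ m → y (finRotate m i) = y i) : y = diagEmb n m (y 0) := by
  have hmain : ∀ k (hk : k < m), y ⟨k, hk⟩ = y 0 := by
    intro k
    induction k with
    | zero => exact fun hk => rfl
    | succ k ih =>
      intro hk
      rw [← ih (by omega), ← hy ⟨k, by omega⟩ (by dsimp only; omega)]
      congr 1
      apply Fin.ext
      rw [coe_finRotate_eq_ite, if_neg (by dsimp only; omega)]
  exact funext fun i => hmain i i.2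

/-- The first `m - 1` entries of the fixed-point equation force all entries of `y` to be equal; the
last then says that their common value commutes with `s`. -/
theorem dualG_twistedCentralizer [NeZero m] (s : GL (Fin n) ℂ) :
    (dualG hm hθ n α).twistedCentralizer (lastEntry m s) =
      ((dualH F n α).twistedCentralizer s).map (diagEmb n m) := by
  ext y
  rw [DualSide.mem_twistedCentralizer, Subgroup.mem_map]
  change lastEntry m s * shift n m y * (lastEntry m s)⁻¹ = y ↔ _
  constructor
  · intro h
    have hc : y = diagEmb n m (y 0) := eq_diagEmb fun i hi => by
      have := congrFun h i
      simpa [lastEntry, hi, shift_apply] using this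
    refine ⟨y 0, ?_, hc.symm⟩
    change s * y 0 * s⁻¹ = y 0
    have hlt : m - 1 < m := by have := NeZero.pos m; omega
    have h1 := congrFun h ⟨m - 1, hlt⟩
    rw [hc] at h1
    simpa [lastEntry, shift_apply, Nat.sub_add_cancel (NeZero.one_le : 1 ≤ m)] using h1
  · rintro ⟨t, ht, rfl⟩
    rw [DualSide.mem_twistedCentralizer] at ht
    funext i
    change lastEntry m s i * t * (lastEntry m s i)⁻¹ = t
    rw [lastEntry]
    split_ifs
    · exact ht
    · simp

theorem dualG_connCentralizer [NeZero m] (s : GL (Fin n) ℂ) :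
    (dualG hm hθ n α).connCentralizer (lastEntry m s) =
      ((dualH F n α).connCentralizer s).map (diagEmb n m) := by
  rw [DualSide.connCentralizer_eq, dualG_twistedCentralizer hm hθ s, neutral_map_diagEmb,
    DualSide.connCentralizer_eq]

theorem dualG_centerInvariants [NeZero m] :
    (dualG hm hθ n α).centerInvariants =
      (dualH F n α).centerInvariants.map (diagEmb n m) := by
  rw [dualH_centerInvariants]
  ext z
  constructor
  · rintro ⟨⟨hz, hz'⟩, -⟩
    have hc : z = diagEmb n m (z 0) := eq_diagEmb fun i _ => congrFun hz' i
    exact ⟨z 0, mem_center_pi.mp hz 0, hc.symm⟩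
  · rintro ⟨c, hc, rfl⟩
    refine Subgroup.mem_inf.mpr ⟨Subgroup.mem_inf.mpr ⟨mem_center_pi.mpr fun _ => hc, rfl⟩, ?_⟩
    refine Subgroup.mem_iInf.mpr fun w => ?_
    obtain ⟨k, hk⟩ := dualG_galAct_mem_zpowers (α := α) (n := n) hm hθ w
    change (dualG hm hθ n α).galAct w _ = _
    rw [hk, shift_zpow_diagEmb]
    rfl

theorem dualH_conj_eq_of_mem {s y : GL (Fin n) ℂ}
    (hy : y ∈ (dualH F n α).connCentralizer s) : s * y * s⁻¹ = y := by
  have h := DualSide.twisted_eq_of_mem hy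
  exact h

/-- The entries `h` and `h s` conjugate an element commuting with `s` in the same way. Hence the
action of `(h, φ)` on the diagonal torus is the one for `H`. -/
theorem hVector_conj_diagEmb (a : ℤ) (h : GL (Fin n) ℂ) {s y : GL (Fin n) ℂ}
    (hy : s * y * s⁻¹ = y) :
    hVector m a h s * diagEmb n m y * (hVector m a h s)⁻¹ = diagEmb n m (h * y * h⁻¹) := by
  funext i
  change hVector m a h s i * y * (hVector m a h s i)⁻¹ = h * y * h⁻¹
  rw [hVector]
  split_ifs
  · rfl
  · conv_rhs => rw [← hy]
    group

theorem dualG_frobInvariants [NeZero m] {a : ℤ} {φ : weilGroup F}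
    (hgal : (dualG hm hθ n α).galAct φ = shift n m ^ (-a)) (s h : GL (Fin n) ℂ) :
    (dualG hm hθ n α).frobInvariants (lastEntry m s) (hVector m a h s) φ =
      ((dualH F n α).frobInvariants s h φ).map (diagEmb n m) := by
  have key : ∀ t ∈ (dualH F n α).connCentralizer s,
      hVector m a h s * (dualG hm hθ n α).galAct φ (diagEmb n m t) * (hVector m a h s)⁻¹ =
        diagEmb n m (h * t * h⁻¹) := by
    intro t ht
    have ht' : s * t * s⁻¹ = t := dualH_conj_eq_of_mem ht
    rw [hgal, shift_zpow_diagEmb, hVector_conj_diagEmb a h ht']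
  ext y
  rw [DualSide.mem_frobInvariants, dualG_connCentralizer hm hθ s]
  constructor
  · rintro ⟨⟨t, ht, rfl⟩, hy⟩
    rw [key t ht] at hy
    exact ⟨t, DualSide.mem_frobInvariants.mpr ⟨ht, diagEmb_injective hy⟩, rfl⟩
  · rintro ⟨t, ht, rfl⟩
    have ht' := DualSide.mem_frobInvariants.mp ht
    refine ⟨⟨t, ht'.1, rfl⟩, ?_⟩
    rw [key t ht'.1]
    exact congrArg _ ht'.2

theorem dualG_elliptic_iff [NeZero m] {a : ℤ} {φ : weilGroup F}
    (hgal : (dualG hm hθ n α).galAct φ = shift n m ^ (-a)) (s h : GL (Fin n) ℂ) :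
    neutral ((dualG hm hθ n α).frobInvariants (lastEntry m s) (hVector m a h s) φ) =
        neutral (dualG hm hθ n α).centerInvariants ↔
      neutral ((dualH F n α).frobInvariants s h φ) = neutral (dualH F n α).centerInvariants := by
  rw [dualG_frobInvariants hm hθ hgal, dualG_centerInvariants, neutral_map_diagEmb,
    neutral_map_diagEmb]
  exact (Subgroup.map_injective diagEmb_injective).eq_iff

/-- Passage from data for `(H, ω)` to data for `(G̃, ω_E)`. -/
theorem dualG_isFrobDatum [NeZero m] {a : ℤ} {φ : weilGroup F}
    (hgal : (dualG hm hθ n α).galAct φ = shift n m ^ (-a)) {T : FTorus F} {s h : GL (Fin n) ℂ}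
    (hT : (dualH F n α).IsFrobDatum T s h φ) :
    (dualG hm hθ n α).IsFrobDatum T (lastEntry m s) (hVector m a h s) φ := by
  obtain ⟨⟨ι, hinj, hrange, hcoeff, hact⟩, hI, ⟨z, hz, hcoc⟩, hell⟩ := hT
  refine ⟨⟨(diagEmb n m).comp ι, diagEmb_injective.comp hinj, ?_, ?_, fun t => ?_⟩, hI,
    ⟨1, one_mem _, ?_⟩, (dualG_elliptic_iff hm hθ hgal s h).mpr hell⟩
  · rw [MonoidHom.range_comp, hrange, dualG_connCentralizer hm hθ s]
  · rintro _ ⟨⟨k, i, j⟩, rfl⟩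
    exact hcoeff _ ⟨(i, j), rfl⟩
  · have ht : ι t ∈ (dualH F n α).connCentralizer s := hrange ▸ ⟨t, rfl⟩
    have ht' : s * ι t * s⁻¹ = ι t := dualH_conj_eq_of_mem ht
    rw [MonoidHom.comp_apply, hgal, shift_zpow_diagEmb, hVector_conj_diagEmb a h ht']
    exact congrArg _ (hact t)
  · rw [hgal, inv_one, one_mul, map_one, mul_one]
    exact hVector_cocycle a ((dualH_cocycle_iff hz).mp hcoc)

/-- Passage from data for `(G̃, ω_E)` to data for `(H, ω)`. -/
theorem dualH_isFrobDatum [NeZero m] {a : ℤ} {φ : weilGroup F}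
    (hgal : (dualG hm hθ n α).galAct φ = shift n m ^ (-a)) {T : FTorus F} {s h : GL (Fin n) ℂ}
    (hsh : s * h * s⁻¹ = h * Matrix.GeneralLinearGroup.scalar (Fin n) α)
    (hT : (dualG hm hθ n α).IsFrobDatum T (lastEntry m s) (hVector m a h s) φ) :
    (dualH F n α).IsFrobDatum T s h φ := by
  obtain ⟨⟨ι, hinj, hrange, hcoeff, hact⟩, hI, -, hell⟩ := hT
  rw [dualG_connCentralizer hm hθ s] at hrange
  have hι : ∀ t, ι t ∈ ((dualH F n α).connCentralizer s).map (diagEmb n m) := fun t =>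
    hrange ▸ ⟨t, rfl⟩
  have hι' : ∀ t, diagEmb n m (ι t 0) = ι t := fun t => by
    obtain ⟨u, -, hu⟩ := hι t
    rw [← hu]
    rfl
  have hιc : ∀ t, ι t 0 ∈ (dualH F n α).connCentralizer s := fun t => by
    obtain ⟨u, hu, hut⟩ := hι t
    rw [← hut]
    exact hu
  refine ⟨⟨(Pi.evalMonoidHom _ 0).comp ι, fun t t' htt => hinj ?_, ?_, ?_, fun t => ?_⟩, hI,
    ⟨1, one_mem _, (dualH_cocycle_iff (one_mem _)).mpr hsh⟩,
    (dualG_elliptic_iff hm hθ hgal s h).mp hell⟩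
  · rw [← hι' t, ← hι' t']
    exact congrArg _ htt
  · ext y
    constructor
    · rintro ⟨t, rfl⟩
      exact hιc t
    · intro hy
      have : diagEmb n m y ∈ ι.range := hrange ▸ ⟨y, hy, rfl⟩
      obtain ⟨t, ht⟩ := this
      exact ⟨t, congrFun ht 0⟩
  · rintro _ ⟨⟨i, j⟩, rfl⟩
    exact hcoeff _ ⟨(0, i, j), rfl⟩
  · have h1 := hact t
    have ht : s * ι t 0 * s⁻¹ = ι t 0 := dualH_conj_eq_of_mem (hιc t)
    rw [hgal, ← hι' t, shift_zpow_diagEmb, hVector_conj_diagEmb a h ht] at h1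
    exact congrFun h1 0

/-- The triple attached to a pair `(s, h)` of elements of `GL(n, ℂ)`. -/
def normalTriple (T : FTorus F) (a : ℤ) (s h : GL (Fin n) ℂ) (φ : weilGroup F) :
    (dualG hm hθ n α).Triple :=
  ⟨T, (dualG hm hθ n α).frobGroup (lastEntry m s) (hVector m a h s) φ, lastEntry m s⟩

/-- Every datum for `(G̃, ω_E)` is isomorphic to one of the form `normalTriple`. -/
theorem dualG_exists_normal [NeZero m] (hE : E ≤ maxUnramified F) {a : ℤ} {φ : weilGroup F}
    (hφ : IsFrobeniusElt F (φ : GaloisGroup F))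
    (hgal : (dualG hm hθ n α).galAct φ = shift n m ^ (-a)) {T : (dualG hm hθ n α).Triple}
    (hT : T.IsDatum) :
    ∃ s h : GL (Fin n) ℂ, s * h * s⁻¹ = h * Matrix.GeneralLinearGroup.scalar (Fin n) α ∧
      (dualG hm hθ n α).IsFrobDatum T.torus (lastEntry m s) (hVector m a h s) φ ∧
      T.Iso (normalTriple hm hθ T.torus a s h φ) := by
  have hD := dualG_isUnramified (n := n) (α := α) hm hθ hE
  obtain ⟨v, hv⟩ := hT.surj φ
  have hK := hT.isFrobDatum hD hφ hv
  obtain ⟨z, hz, hcoc⟩ := hK.cocycle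
  -- Translating by the very `z` of the cocycle condition cancels its coboundary, as
  -- `exists_eq_hVector` requires the value `(1, …, 1, α)` exactly.
  obtain ⟨x, s, hx⟩ := lastEntry_coboundary (z * T.s)
  have hs : z * (x * T.s * ((dualG hm hθ n α).theta x)⁻¹) = lastEntry m s := by
    rw [← hx, ← mul_assoc x, Subgroup.mem_center_iff.mp hz x]
    simp only [mul_assoc]
    rfl
  have hcoc' := DualSide.cocycle_conj hD hz hz hcoc x
  have hK' := hK.conj hD x hz
  rw [hs, mul_inv_cancel, inv_one, one_mul, map_one, mul_one, hgal] at hcoc'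
  obtain ⟨h, hh, hsh⟩ := exists_eq_hVector a hcoc'
  rw [hs, hgal, hh] at hK'
  refine ⟨s, h, hsh, hK', ?_⟩
  refine DualSide.frobGroup_iso hD hφ hφ (hT.group_eq hφ hv) rfl (inv_mem hz) (x := x) (y := 1)
    (h₂ := hVector m a h s) ?_ (one_mem _) ?_
  · rw [eq_inv_mul_iff_mul_eq]
    exact hs
  · rw [one_mul, hgal, hh]

theorem normalTriple_iso [NeZero m] (hE : E ≤ maxUnramified F) (hn : 1 ≤ n)
    (hα : orderOf α = n) {a : ℤ} {φ : weilGroup F} (hφ : IsFrobeniusElt F (φ : GaloisGroup F))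
    (hgal : (dualG hm hθ n α).galAct φ = shift n m ^ (-a)) (T₁ T₂ : FTorus F)
    {s₁ h₁ s₂ h₂ : GL (Fin n) ℂ}
    (hsh₁ : s₁ * h₁ * s₁⁻¹ = h₁ * Matrix.GeneralLinearGroup.scalar (Fin n) α)
    (hsh₂ : s₂ * h₂ * s₂⁻¹ = h₂ * Matrix.GeneralLinearGroup.scalar (Fin n) α) :
    (normalTriple (α := α) hm hθ T₁ a s₁ h₁ φ).Iso (normalTriple hm hθ T₂ a s₂ h₂ φ) := by
  have hD := dualG_isUnramified (n := n) (α := α) hm hθ hE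
  obtain ⟨x, c, g, hs, hh⟩ := exists_conj_of_twist hn hα hsh₁ hsh₂
  -- The scalar `c` affects only the last entry of `s̃`, so it is not by itself a central
  -- translation. Conjugation by the entries `ν ^ i x` spreads it evenly: every entry acquires the
  -- factor `ν⁻¹`, the last because `ν ^ (m - 1) c = ν⁻¹`.
  obtain ⟨ν₀, hν₀⟩ := IsAlgClosed.exists_pow_nat_eq ((c⁻¹ : ℂˣ) : ℂ) (NeZero.pos m)
  have hν₀0 : ν₀ ≠ 0 := by
    rintro rfl
    rw [zero_pow (NeZero.ne m)] at hν₀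
    exact (c⁻¹).ne_zero hν₀.symm
  obtain ⟨ν, hν⟩ : ∃ ν : ℂˣ, ν ^ (m : ℤ) = c⁻¹ :=
    ⟨Units.mk0 ν₀ hν₀0, by rw [zpow_natCast]; exact Units.ext (by simpa using hν₀)⟩
  set σ := Matrix.GeneralLinearGroup.scalar (Fin n) (R := ℂ) with hσ
  -- a scalar factor can be moved to the front
  have key : ∀ (k l : ℤ) (u : GL (Fin n) ℂ),
      σ (ν ^ k) * x * u * (σ (ν ^ l) * x)⁻¹ = σ (ν ^ (k - l)) * (x * u * x⁻¹) := by
    intro k l u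
    have h1 : (σ (ν ^ l) * x)⁻¹ = σ (ν ^ (-l)) * x⁻¹ := by
      rw [mul_inv_rev, ← map_inv, ← zpow_neg, scalarGL_comm]
    rw [h1, ← mul_assoc, mul_assoc _ u, scalarGL_comm, ← mul_assoc, mul_assoc _ x,
      scalarGL_comm, sub_eq_add_neg, zpow_add, map_mul]
    simp only [mul_assoc, hσ]
  have hm0 : (0 : ℤ) < m := by exact_mod_cast NeZero.pos m
  have hr0 := Int.emod_nonneg a hm0.ne'
  have hr1 := Int.emod_lt_of_pos a hm0
  -- With `r = a % m`, the factor in front of `h` is `ν ^ (r - m) g` and that in front of `h s` is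
  -- `ν ^ r g c`. They agree because `ν ^ m = c⁻¹`, so `y` is a diagonally embedded scalar and lies
  -- in `Ĝ_s̃`.
  refine DualSide.frobGroup_iso hD hφ hφ rfl rfl (x := fun i => σ (ν ^ ((i : ℕ) : ℤ)) * x)
    (y := diagEmb n m (σ (ν ^ (a % m) * g * c))) (z := diagEmb n m (σ ν⁻¹))
    (h₁ := hVector m a h₁ s₁) (h₂ := hVector m a h₂ s₂)
    (mem_center_pi.mpr fun _ => scalarGL_mem_center _) ?_ ?_ ?_
  · funext i
    have h1 := coe_finRotate_eq_ite i
    change σ _ * x * lastEntry m s₁ i * (σ _ * x)⁻¹ = σ ν⁻¹ * lastEntry m s₂ i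
    rw [key, h1]
    simp only [lastEntry]
    split_ifs with hi
    · rw [hs, ← mul_assoc, ← map_mul]
      congr 2
      rw [Nat.cast_zero, sub_zero, show ((i : ℕ) : ℤ) = m + (-1) by omega, zpow_add, hν,
        zpow_neg_one, mul_right_comm, inv_mul_cancel, one_mul]
    · rw [mul_one, mul_inv_cancel]
      congr 2
      rw [show ((i : ℕ) : ℤ) - ((((i : ℕ) + 1 : ℕ)) : ℤ) = -1 by omega, zpow_neg_one]
  · change _ ∈ (dualG hm hθ n α).connCentralizer (lastEntry m s₂)
    rw [dualG_connCentralizer hm hθ s₂]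
    exact ⟨_, scalarGL_mem_connCentralizer s₂ _, rfl⟩
  · rw [hgal]
    funext i
    have h2 := coe_finRotate_zpow_neg a i
    simp only [Pi.mul_apply, Pi.inv_apply, shift_zpow_apply]
    change σ _ * x * hVector m a h₁ s₁ i * (σ _ * x)⁻¹ = σ _ * hVector m a h₂ s₂ i
    rw [key, h2]
    simp only [hVector]
    by_cases hi : ((i : ℕ) : ℤ) < a % m
    · rw [if_pos hi, if_pos hi, if_neg (by omega), hh, ← mul_assoc, ← map_mul]
      congr 2
      rw [show ((i : ℕ) : ℤ) - ((i : ℕ) - a % m + m) = a % m - m by ring, zpow_sub, hν, inv_inv,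
        mul_right_comm]
    · rw [if_neg hi, if_neg hi, if_pos (by omega)]
      have h3 : x * (h₁ * s₁) * x⁻¹ = σ g * σ c * (h₂ * s₂) := by
        have : x * (h₁ * s₁) * x⁻¹ = (x * h₁ * x⁻¹) * (x * s₁ * x⁻¹) := by group
        rw [this, hs, hh, mul_assoc, ← mul_assoc h₂, scalarGL_comm]
        simp only [mul_assoc, hσ]
      rw [h3, ← map_mul, ← mul_assoc, ← map_mul]
      congr 2
      rw [show ((i : ℕ) : ℤ) - ((i : ℕ) - a % m) = a % m by ring, mul_assoc]

/-- All endoscopic data for `(G̃, ω_E)` are isomorphic. -/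
theorem dualG_iso [NeZero m] (hE : E ≤ maxUnramified F) (hn : 1 ≤ n)
    (hα : orderOf α = n) {a : ℤ} {φ : weilGroup F} (hφ : IsFrobeniusElt F (φ : GaloisGroup F))
    (hgal : (dualG hm hθ n α).galAct φ = shift n m ^ (-a)) {T₁ T₂ : (dualG hm hθ n α).Triple}
    (hT₁ : T₁.IsDatum) (hT₂ : T₂.IsDatum) : T₁.Iso T₂ := by
  obtain ⟨s₁, h₁, hsh₁, -, hi₁⟩ := dualG_exists_normal hm hθ hE hφ hgal hT₁
  obtain ⟨s₂, h₂, hsh₂, -, hi₂⟩ := dualG_exists_normal hm hθ hE hφ hgal hT₂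
  exact hi₁.trans ((normalTriple_iso hm hθ hE hn hα hφ hgal _ _ hsh₁ hsh₂).trans hi₂.symm)

/-- The pair `(s, h)` of the normal form is itself a datum for `H`; semisimplicity of `s` comes from
its `n` distinct eigenvalues. This gives surjectivity of the map on classes. -/
theorem dualH_datum_of_dualG [CharZero F] [NeZero m] (hE : E ≤ maxUnramified F) (hn : 1 ≤ n)
    (hα : orderOf α = n) {a : ℤ} {φ : weilGroup F} (hφ : IsFrobeniusElt F (φ : GaloisGroup F))
    (hgal : (dualG hm hθ n α).galAct φ = shift n m ^ (-a)) (T : (dualG hm hθ n α).Datum) :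
    Nonempty (dualH F n α).Datum := by
  obtain ⟨s, h, hsh, hK, -⟩ := dualG_exists_normal hm hθ hE hφ hgal T.2
  exact ⟨⟨_, (dualH_isFrobDatum hm hθ hgal hsh hK).isDatum dualH_isUnramified hφ
    (exists_conj_mem_diagTorus hn hα hsh)⟩⟩

theorem construct_isDatum [CharZero F] [NeZero m] (hE : E ≤ maxUnramified F) {a : ℤ}
    {φ : weilGroup F} (hφ : IsFrobeniusElt F (φ : GaloisGroup F))
    (hgal : (dualG hm hθ n α).galAct φ = shift n m ^ (-a)) {T : (dualH F n α).Triple}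
    (hT : T.IsDatum) (hs : T.s ∈ diagTorus n) {h : GL (Fin n) ℂ}
    (hh : (⟨h, φ⟩ : (dualH F n α).LGroup) ∈ T.group) :
    (construct hm hθ a T h φ).IsDatum := by
  have hK := dualG_isFrobDatum hm hθ hgal (hT.isFrobDatum dualH_isUnramified hφ hh)
  refine hK.isDatum (dualG_isUnramified hm hθ hE) hφ ⟨1, ?_⟩
  rw [one_mul, map_one, inv_one, mul_one]
  intro i _
  change (if _ then _ else _) ∈ diagTorus n
  split_ifs
  exacts [hs, one_mem _]

end G

end Endoscopy

end

/-! ### The bijection on isomorphism classes. -/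

theorem mainTheorem4
    -- `F` is a non-archimedean local field of characteristic zero
    {F : Type*} [Field F] [CharZero F] [ValuativeRel F] [TopologicalSpace F]
    [IsNonarchimedeanLocalField F]
    -- an unramified character `ω` of `Fˣ` of order `n`, and its value `ω ϖ` at a uniformizer
    (n : ℕ) (hn : 1 ≤ n) (ω : Fˣ →* ℂˣ)
    (hω_unr : ∀ u : 𝒪[F]ˣ, ω (Units.map (Subring.subtype 𝒪[F]).toMonoidHom u) = 1)
    (hω_ord : orderOf ω = n)
    (ϖ : Fˣ) (hϖ : ∃ p : 𝒪[F], Irreducible p ∧ (p : F) = ϖ)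
    -- an unramified extension `E/F` of degree `m`, and a generator `θ` of `Gal(E/F)`
    (E : IntermediateField F (AlgebraicClosure F)) [FiniteDimensional F E] [IsGalois F E]
    (hE : E ≤ maxUnramified F) (m : ℕ) (hm : Module.finrank F E = m)
    (θ : E ≃ₐ[F] E) (hθ : ∀ τ : E ≃ₐ[F] E, τ ∈ Subgroup.zpowers θ)
    -- a Frobenius element `φ` of `W_F`, with `θ` the restriction of `φ ^ e`, and `b m - a e = 1`
    (φ : weilGroup F) (hφ : IsFrobeniusElt F (φ : GaloisGroup F))
    (e a b : ℤ) (he : AlgEquiv.restrictNormalHom E (φ : GaloisGroup F) ^ e = θ)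
    (hab : b * m - a * e = 1) :
    -- the construction gives elliptic unramified endoscopic data for `(G̃, ω_E)`
    (∀ (T : (dualH F n (ω ϖ)).Datum), T.1.s ∈ diagTorus n →
      ∀ (h : GL (Fin n) ℂ) (ψ : weilGroup F), IsFrobeniusElt F (ψ : GaloisGroup F) →
        (⟨h, ψ⟩ : (dualH F n (ω ϖ)).LGroup) ∈ T.1.group →
        (construct hm hθ a T.1 h ψ).IsDatum) ∧
    -- the class of the constructed datum only depends on the class of the initial one
    (∀ (T₁ T₂ : (dualH F n (ω ϖ)).Datum), T₁.1.s ∈ diagTorus n → T₂.1.s ∈ diagTorus n →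
      ∀ (h₁ h₂ : GL (Fin n) ℂ) (ψ₁ ψ₂ : weilGroup F),
        IsFrobeniusElt F (ψ₁ : GaloisGroup F) → IsFrobeniusElt F (ψ₂ : GaloisGroup F) →
        (⟨h₁, ψ₁⟩ : (dualH F n (ω ϖ)).LGroup) ∈ T₁.1.group →
        (⟨h₂, ψ₂⟩ : (dualH F n (ω ϖ)).LGroup) ∈ T₂.1.group →
        T₁.1.Iso T₂.1 →
        (construct hm hθ a T₁.1 h₁ ψ₁).Iso (construct hm hθ a T₂.1 h₂ ψ₂)) ∧
    -- every class contains data to which the construction applies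
    (∀ c : (dualH F n (ω ϖ)).Classes, ∃ (T : (dualH F n (ω ϖ)).Datum) (h : GL (Fin n) ℂ),
      T.cls = c ∧ T.1.s ∈ diagTorus n ∧ (⟨h, φ⟩ : (dualH F n (ω ϖ)).LGroup) ∈ T.1.group) ∧
    -- the induced map on isomorphism classes is bijective
    ∃ f : (dualH F n (ω ϖ)).Classes → (dualG hm hθ n (ω ϖ)).Classes,
      (∀ (T : (dualH F n (ω ϖ)).Datum), T.1.s ∈ diagTorus n →
        ∀ (h : GL (Fin n) ℂ) (ψ : weilGroup F), IsFrobeniusElt F (ψ : GaloisGroup F) →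
          (⟨h, ψ⟩ : (dualH F n (ω ϖ)).LGroup) ∈ T.1.group →
          ∀ hT : (construct hm hθ a T.1 h ψ).IsDatum,
            f T.cls = DualSide.Datum.cls ⟨construct hm hθ a T.1 h ψ, hT⟩) ∧
      Function.Bijective f := by
  have hα : orderOf (ω ϖ) = n := (orderOf_apply_uniformizer hω_unr hϖ).trans hω_ord
  have hmz : NeZero m := ⟨by rw [← hm]; exact Module.finrank_pos.ne'⟩
  have hgal : ∀ ψ : weilGroup F, IsFrobeniusElt F (ψ : GaloisGroup F) →
      (dualG hm hθ n (ω ϖ)).galAct ψ = shift n m ^ (-a) :=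
    fun ψ hψ => dualG_galAct_frob hm hθ hE hφ hψ he hab
  have hdatum : ∀ (T : (dualH F n (ω ϖ)).Datum), T.1.s ∈ diagTorus n →
      ∀ (h : GL (Fin n) ℂ) (ψ : weilGroup F), IsFrobeniusElt F (ψ : GaloisGroup F) →
        (⟨h, ψ⟩ : (dualH F n (ω ϖ)).LGroup) ∈ T.1.group →
        (construct hm hθ a T.1 h ψ).IsDatum :=
    fun T hs h ψ hψ hh => construct_isDatum hm hθ hE hψ (hgal ψ hψ) T.2 hs hh
  have hisoG : ∀ T₁ T₂ : (dualG hm hθ n (ω ϖ)).Triple, T₁.IsDatum → T₂.IsDatum → T₁.Iso T₂ :=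
    fun T₁ T₂ hT₁ hT₂ => dualG_iso hm hθ hE hn hα hφ (hgal φ hφ) hT₁ hT₂
  have hrep : ∀ c : (dualH F n (ω ϖ)).Classes,
      ∃ (T : (dualH F n (ω ϖ)).Datum) (h : GL (Fin n) ℂ), T.cls = c ∧ T.1.s ∈ diagTorus n ∧
        (⟨h, φ⟩ : (dualH F n (ω ϖ)).LGroup) ∈ T.1.group := by
    intro c
    obtain ⟨T, rfl⟩ := Quotient.exists_rep c
    exact dualH_exists_diag hφ T
  refine ⟨hdatum, ?_, hrep, ?_⟩
  · intro T₁ T₂ hs₁ hs₂ h₁ h₂ ψ₁ ψ₂ hψ₁ hψ₂ hh₁ hh₂ _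
    exact hisoG _ _ (hdatum T₁ hs₁ h₁ ψ₁ hψ₁ hh₁) (hdatum T₂ hs₂ h₂ ψ₂ hψ₂ hh₂)
  -- Any choice of representatives defines the map: its compatibility with every construction, and
  -- surjectivity, follow from all data for `G̃` being isomorphic, and injectivity from the same
  -- fact for `H`.
  · choose R k hR hRs hRk using hrep
    refine ⟨fun c => DualSide.Datum.cls
      ⟨construct hm hθ a (R c).1 (k c) φ, hdatum (R c) (hRs c) (k c) φ hφ (hRk c)⟩,
      fun T hs h ψ hψ hh hT => Quotient.sound (hisoG _ _ (hdatum _ (hRs _) _ φ hφ (hRk _)) hT),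
      ?_, ?_⟩
    · intro c₁ c₂ _
      obtain ⟨T₁, rfl⟩ := Quotient.exists_rep c₁
      obtain ⟨T₂, rfl⟩ := Quotient.exists_rep c₂
      exact Quotient.sound (dualH_iso hn hα hφ T₁.2 T₂.2)
    · intro d
      obtain ⟨T, rfl⟩ := Quotient.exists_rep d
      obtain ⟨T'⟩ := dualH_datum_of_dualG hm hθ hE hn hα hφ (hgal φ hφ) T
      exact ⟨T'.cls, Quotient.sound (hisoG _ _ (hdatum _ (hRs _) _ φ hφ (hRk _)) T.2)⟩
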